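/- Let $U\subset\mathbb R^3$ be open and connected and let $f:U\to\mathbb R^3$ be a $C^\infty$ map such that the system of conservation laws $u^i_t=f^i(u)_x$ ($i=1,2,3$) is strictly hyperbolic: at every $u\in U$ the Jacobi matrix $(\partial f^i/\partial u^j)$ has three distinct real eigenvalues $\lambda^1(u)<\lambda^2(u)<\lambda^3(u)$. A rarefaction curve of the $i$-th family is a regular $C^1$ curve in $U$ whose velocity is at each of its points an eigenvector for $\lambda^i$. The system is called a T-system if every rarefaction curve lies on a straight line and, for each $i$, $\lambda^i$ is constant along the rarefaction curves of the $i$-th family. To the system one attaches the congruence of lines $y^i=u^iy^0-f^i(u)$ ($i=1,2,3$, $u\in U$) in $P^4$ with affine coordinates $y^0,\dots,y^3$; its developable surfaces are the one-parameter families of lines of the congruence along regular $C^1$ curves in $U$ that form a ruled surface whose tangent plane is the same at all points of each line. Theorem. (i) The system is a T-system if and only if all developable surfaces of its congruence are planar pencils of lines, i.e. the lines of each of them pass through a common point and lie in a common plane of $P^4$. (ii) If the system is a T-system (equivalently, if the developable surfaces of the congruence are planar pencils of lines), then the congruence is linear: its image in the Plücker space $P^9$, with the Plücker coordinates $1,\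 u^i,\ f^i,\ u^if^j-u^jf^i$ $(i<j)$, lies in a linear subspace of codimension three. More precisely, there are three linearly independent linear equations in the Plücker coordinates such that for every $u\in U$ and $p\in\mathbb R^3$ the line $y^i=u^iy^0-p^i$ satisfies them if and only if $p=f(u)$. -/

import Mathlib

open scoped ContDiff

noncomputable section

/-- The system of conservation laws `u^i_t = f^i(u)_x` is strictly hyperbolic on `U`, with
characteristic velocities `lam 0 < lam 1 < ...`: at every point of `U` the numbers `lam i u` are
`n` distinct real eigenvalues (hence all the eigenvalues) of the Jacobi matrix of `f`. -/
def IsStrictlyHyperbolic {n : ℕ} (f : (Fin n → ℝ) → (Fin n → ℝ)) (U : Set (Fin n → ℝ))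
    (lam : Fin n → (Fin n → ℝ) → ℝ) : Prop :=
  ∀ u ∈ U, StrictMono (fun i => lam i u) ∧
    ∀ i, Module.End.HasEigenvalue
      ((fderiv ℝ f u : (Fin n → ℝ) →L[ℝ] (Fin n → ℝ)) : (Fin n → ℝ) →ₗ[ℝ] (Fin n → ℝ)) (lam i u)

/-- `γ`, on the open interval `I` (possibly unbounded), is a (regularly parametrized) rarefaction
curve of the `i`-th family: a curve in `U` whose velocity is everywhere an eigenvector of the
Jacobi matrix of `f` for the `i`-th characteristic velocity. -/
structure IsRarefactionCurve {n : ℕ} (f : (Fin n → ℝ) → (Fin n → ℝ)) (U : Set (Fin n → ℝ))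
    (lam : Fin n → (Fin n → ℝ) → ℝ) (i : Fin n) (I : Set ℝ) (γ : ℝ → (Fin n → ℝ)) : Prop where
  isOpen : IsOpen I
  ordConnected : I.OrdConnected
  mem : ∀ t ∈ I, γ t ∈ U
  contDiffOn : ContDiffOn ℝ 1 γ I
  velocity_ne_zero : ∀ t ∈ I, deriv γ t ≠ 0
  eigenvector : ∀ t ∈ I, fderiv ℝ f (γ t) (deriv γ t) = lam i (γ t) • deriv γ t

/-- A T-system: all rarefaction curves are straight, and the `i`-th characteristic velocity is
constant along the rarefaction curves of the `i`-th family. -/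
structure IsTSystem {n : ℕ} (f : (Fin n → ℝ) → (Fin n → ℝ)) (U : Set (Fin n → ℝ))
    (lam : Fin n → (Fin n → ℝ) → ℝ) : Prop where
  straight : ∀ i I γ, IsRarefactionCurve f U lam i I γ →
    ∃ p v : Fin n → ℝ, ∀ t ∈ I, ∃ s : ℝ, γ t = p + s • v
  linearlyDegenerate : ∀ i I γ, IsRarefactionCurve f U lam i I γ →
    ∃ c : ℝ, ∀ t ∈ I, lam i (γ t) = c

/-- Homogeneous coordinates `(Y : y^0 : y^1 : ... : y^n)` on `P^{n+1}`; the affine chart is `Y = 1`.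
This is the point `y^0 = 0`, `y^i = - p^i` of the line `y^i = u^i y^0 - p^i`. -/
def affinePoint {n : ℕ} (p : Fin n → ℝ) : Fin (n + 2) → ℝ :=
  Matrix.vecCons 1 (Matrix.vecCons 0 (-p))

/-- The point at infinity of the line `y^i = u^i y^0 - p^i`. -/
def pointAtInfinity {n : ℕ} (u : Fin n → ℝ) : Fin (n + 2) → ℝ :=
  Matrix.vecCons 0 (Matrix.vecCons 1 u)

/-- The projective line `y^i = u^i y^0 - p^i` in `P^{n+1}`, as a plane in `ℝ^{n+2}`. -/
def projLine {n : ℕ} (u p : Fin n → ℝ) : Submodule ℝ (Fin (n + 2) → ℝ) :=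
  Submodule.span ℝ {affinePoint p, pointAtInfinity u}

/-- In the affine chart `projLine u p` is given by `y^i = u^i y^0 - p^i`. -/
theorem mem_projLine_iff {n : ℕ} (u p y : Fin n → ℝ) (y₀ : ℝ) :
    (Matrix.vecCons 1 (Matrix.vecCons y₀ y) : Fin (n + 2) → ℝ) ∈ projLine u p ↔
      ∀ i, y i = u i * y₀ - p i := by
  rw [projLine, Submodule.mem_span_pair]
  constructor
  · rintro ⟨a, b, h⟩ i
    have h0 := congrFun h 0
    have h1 := congrFun h 1
    have h2 := congrFun h i.succ.succ
    simp [affinePoint, pointAtInfinity] at h0 h1 h2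
    subst h0 h1
    rw [← h2]; ring
  · intro h
    refine ⟨1, y₀, ?_⟩
    ext j
    refine Fin.cases ?_ (fun j => Fin.cases ?_ (fun i => ?_) j) j
    · simp [affinePoint, pointAtInfinity]
    · simp [affinePoint, pointAtInfinity]
    · simp [affinePoint, pointAtInfinity, h i]; ring

/-- The lines of the congruence `y^i = u^i y^0 - f^i(u)` along the regular curve `γ` in `U`,
parametrized by the open interval `I`, form a developable surface: its tangent space, which at the
points of the line `t` is contained in the span of the two points spanning this line and of their
velocities, is at most a plane of `P^{n+1}`, the same along the whole line. -/
structure IsDevelopableAlong {n : ℕ} (f : (Fin n → ℝ) → (Fin n → ℝ)) (U : Set (Fin n → ℝ))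
    (I : Set ℝ) (γ : ℝ → (Fin n → ℝ)) : Prop where
  isOpen : IsOpen I
  ordConnected : I.OrdConnected
  mem : ∀ t ∈ I, γ t ∈ U
  contDiffOn : ContDiffOn ℝ 1 γ I
  velocity_ne_zero : ∀ t ∈ I, deriv γ t ≠ 0
  finrank_le : ∀ t ∈ I, Module.finrank ℝ (Submodule.span ℝ
    ({affinePoint (f (γ t)), pointAtInfinity (γ t),
      deriv (fun s => affinePoint (f (γ s))) t,
      deriv (fun s => pointAtInfinity (γ s)) t} : Set (Fin (n + 2) → ℝ))) ≤ 3

/-- The developable surfaces of the congruence `y^i = u^i y^0 - f^i(u)` are planar pencils of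
lines: all the lines of the surface pass through a common point and lie in a common plane of
`P^{n+1}`. -/
def DevelopablesArePlanarPencils {n : ℕ} (f : (Fin n → ℝ) → (Fin n → ℝ))
    (U : Set (Fin n → ℝ)) : Prop :=
  ∀ I γ, IsDevelopableAlong f U I γ →
    ∃ vertex plane : Submodule ℝ (Fin (n + 2) → ℝ),
      Module.finrank ℝ vertex = 1 ∧ Module.finrank ℝ plane = 3 ∧
      ∀ t ∈ I, vertex ≤ projLine (γ t) (f (γ t)) ∧ projLine (γ t) (f (γ t)) ≤ plane

/-- The space of Plücker coordinates of lines in the projectivization of `ℝ^m`. -/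
abbrev PluckerSpace (m : ℕ) : Type := {q : Fin m × Fin m // q.1 < q.2} → ℝ

/-- The Plücker coordinates of the line through the points `v` and `w`. -/
def pluckerCoords {m : ℕ} (v w : Fin m → ℝ) : PluckerSpace m :=
  fun q => v q.1.1 * w q.1.2 - v q.1.2 * w q.1.1

/-- The Plücker coordinates `1`, `u^i`, `p^i`, `u^i p^j - u^j p^i` of the line
`y^i = u^i y^0 - p^i`. -/
def linePlucker {n : ℕ} (u p : Fin n → ℝ) : PluckerSpace (n + 2) :=
  pluckerCoords (affinePoint p) (pointAtInfinity u)

/-- The congruence `y^i = u^i y^0 - f^i(u)`, `u ∈ U`, is linear: there are `n` linearly independent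
linear equations in the Plücker coordinates (a linear subspace of codimension `n`) which hold for
the lines of the congruence and, among all lines `y^i = u^i y^0 - p^i` with `u ∈ U`, for no other. -/
def IsLinearCongruence {n : ℕ} (f : (Fin n → ℝ) → (Fin n → ℝ)) (U : Set (Fin n → ℝ)) : Prop :=
  ∃ E : Fin n → Module.Dual ℝ (PluckerSpace (n + 2)), LinearIndependent ℝ E ∧
    ∀ u ∈ U, ∀ p : Fin n → ℝ, (∀ k, E k (linePlucker u p) = 0) ↔ p = f u

end

/-!
The proof turns on the second derivative of `f`. For an eigenvector field `r i` of the Jacobi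
matrix, `D²f(r i, r i)` has the component `∂_{r i} (lam i)` along `r i`, and its other components
measure the bending of the integral curves; so a T-system satisfies `D²f(r i, r i) = 0` for all `i`
(`IsTSystem.fderiv_fderiv_eigenvector`, by differentiating along an integral curve of `r i`).

Part (i) is direct. A family of lines is developable along a curve exactly when the velocity of the
curve is an eigenvector of the Jacobi matrix, and the family `i` of this eigenvector cannot change
along the curve. If `lam i = c` along the curve, then `f - c u` is constant along it, and this is
the common point of the lines; the curve is straight exactly when the lines lie in a plane.

For part (ii), let `ψ = α + β(u) + γ(f(u)) + δ(u, f(u))`, with `δ` alternating, be the restriction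
to the congruence of a linear function of the Plücker coordinates. In a T-system also
`D²ψ(r i, r i) = 0`. Differentiating this expresses `D³ψ(a, r i, r i)` by `D²ψ`. The only third
derivative left is the mixed one, and the main point is that

  `D³ψ(r 0, r 1, r 2) = ∑ c_ij D²ψ(r i, r j)`,  `c_ij = ∂_{r k} log (lam j - lam i)`.

For these coefficients the terms with `δ` agree (`thirdFDeriv_congruenceFunction_eq`), and the
difference of the two sides is the value of the covector `γ + δ(u, ·)` on a vector that depends on
`f` only, `mixedResidual`. It vanishes for two different reasons:
* at a point where some plane field `⟨r i, r j⟩` is not integrable: choose `ψ` with `D²ψ = 0` at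
  this point and `γ + δ(u, ·)` arbitrary. Differentiating `D²ψ(r i, r i) = 0` twice expresses
  `D⁴ψ(r j, r j, r i, r i)` by `D³ψ(r 0, r 1, r 2)`, and the symmetry of `D⁴ψ` in the two pairs of
  arguments then gives `D³ψ(r 0, r 1, r 2) = 0` (`thirdFDeriv_eq_zero`);
* where all plane fields are integrable near the point: by differentiating the integrability
  condition `l k (D²f(r i, r j)) = 0` along `r k` (`l_apply_thirdFDeriv`).
These two kinds of points are dense, and the claim is closed (`mixedResidual_eq_zero`).

Hence `ψ` satisfies a closed linear system of third order, and `ψ` vanishes on the connected set `U`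
as soon as its second jet vanishes at one point (`congruenceFunction_eq_zero`). At a given point
the jet condition leaves exactly the covector `γ + δ(u, ·)` free, which gives the three equations.
The same argument at another point `u` shows that the three covectors `γ + δ(u, ·)` remain linearly
independent there, so that the equations determine `p = f(u)`.
-/

noncomputable section

open Filter Topology Module

/-! ### Smooth frames of eigenvectors -/

section Eigenframe

variable {n : ℕ} {f : (Fin n → ℝ) → (Fin n → ℝ)} {U : Set (Fin n → ℝ)}
  {lam : Fin n → (Fin n → ℝ) → ℝ} {u : Fin n → ℝ}

theorem IsStrictlyHyperbolic.exists_eigenbasis (hyp : IsStrictlyHyperbolic f U lam)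
    (hu : u ∈ U) :
    ∃ b : Basis (Fin n) ℝ (Fin n → ℝ), ∀ i, fderiv ℝ f u (b i) = lam i u • b i := by
  obtain ⟨hmono, heig⟩ := hyp u hu
  choose v hv using fun i => (heig i).exists_hasEigenvector
  have hli := Module.End.eigenvectors_linearIndependent' _ _ hmono.injective v hv
  refine ⟨basisOfLinearIndependentOfCardEqFinrank' v hli (by simp), fun i => ?_⟩
  simpa using (hv i).apply_eq_smul

theorem IsStrictlyHyperbolic.eigenvalue_eq (hyp : IsStrictlyHyperbolic f U lam)
    (hu : u ∈ U) {v : Fin n → ℝ} (hv : v ≠ 0) {μ : ℝ} (h : fderiv ℝ f u v = μ • v) :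
    ∃ i, μ = lam i u := by
  obtain ⟨b, hb⟩ := hyp.exists_eigenbasis hu
  obtain ⟨i, hi⟩ : ∃ i, b.repr v i ≠ 0 := by
    by_contra! hcon
    exact hv (b.repr.injective (by ext i; simpa using hcon i))
  refine ⟨i, ?_⟩
  have h1 : fderiv ℝ f u v = ∑ j, b.repr v j • (lam j u • b j) := by
    conv_lhs => rw [← b.sum_repr v]
    simp only [map_sum, map_smul, hb]
  have h2 : b.repr (fderiv ℝ f u v) i = lam i u * b.repr v i := by
    rw [h1]
    simp [Finsupp.single_apply, mul_comm]
  rw [h] at h2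
  simp only [map_smul, Finsupp.smul_apply, smul_eq_mul] at h2
  exact mul_right_cancel₀ hi h2

/-- A simple eigenvalue of a diagonalizable endomorphism is a nondegenerate solution of the
equation `M ρ = μ ρ` with `ρ` normalized by the dual basis. -/
theorem eigenpair_linearization_injective {E : Type*} [AddCommGroup E] [Module ℝ E]
    {ι : Type*} (b : Basis ι ℝ E) (M : E →ₗ[ℝ] E) (c : ι → ℝ)
    (hc : Function.Injective c) (hb : ∀ j, M (b j) = c j • b j) (i : ι) {ρ : E} {μ : ℝ}
    (h : M ρ - c i • ρ - μ • b i = 0) (hρ : b.repr ρ i = 0) : ρ = 0 ∧ μ = 0 := by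
  have key : ∀ (j : ι) (v : E), b.repr (M v) j = c j * b.repr v j := by
    intro j v
    have : b.coord j ∘ₗ M = c j • b.coord j := by
      refine b.ext fun k => ?_
      by_cases hkj : k = j
      · subst hkj; simp [hb]
      · simp [hb, hkj]
    simpa using LinearMap.congr_fun this v
  have h' : ∀ j, (c j - c i) * b.repr ρ j - μ * b.repr (b i) j = 0 := by
    intro j
    have := congrArg (fun v => b.repr v j) h
    simp only [map_sub, map_smul, Finsupp.sub_apply, Finsupp.smul_apply, key, smul_eq_mul,
      map_zero, Finsupp.zero_apply] at this
    linarith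
  have hμ : μ = 0 := by simpa using h' i
  refine ⟨b.repr.injective ?_, hμ⟩
  ext j
  by_cases hji : j = i
  · simp [hji, hρ]
  · have h1 := h' j
    rw [hμ, zero_mul, sub_zero] at h1
    simpa [sub_ne_zero.2 (hc.ne hji)] using h1

/-- An eigenvector and its simple eigenvalue extend smoothly, by the implicit function theorem. -/
theorem IsStrictlyHyperbolic.exists_smooth_eigenpair (hyp : IsStrictlyHyperbolic f U lam)
    (hu : u ∈ U) (hf : ContDiffAt ℝ 2 (fderiv ℝ f) u)
    (b : Basis (Fin n) ℝ (Fin n → ℝ)) (hb : ∀ i, fderiv ℝ f u (b i) = lam i u • b i)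
    (i : Fin n) :
    ∃ (r : (Fin n → ℝ) → (Fin n → ℝ)) (μ : (Fin n → ℝ) → ℝ),
      ContDiffAt ℝ 2 r u ∧ ContDiffAt ℝ 2 μ u ∧ r u = b i ∧ μ u = lam i u ∧
      ∀ᶠ x in 𝓝 u, fderiv ℝ f x (r x) = μ x • r x := by
  set l : (Fin n → ℝ) →L[ℝ] ℝ := (b.coord i).toContinuousLinearMap with hl
  have hlb : ∀ v, l v = b.repr v i := fun v => rfl
  let F : (Fin n → ℝ) × ((Fin n → ℝ) × ℝ) → (Fin n → ℝ) × ℝ :=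
    fun q => (fderiv ℝ f q.1 q.2.1 - q.2.2 • q.2.1, l q.2.1)
  let q₀ : (Fin n → ℝ) × ((Fin n → ℝ) × ℝ) := (u, (b i, lam i u))
  have hF : ContDiffAt ℝ 2 F q₀ := by
    have h1 : ContDiffAt ℝ 2 (fun q : (Fin n → ℝ) × ((Fin n → ℝ) × ℝ) => fderiv ℝ f q.1) q₀ :=
      ContDiffAt.comp (g := fderiv ℝ f) q₀ hf contDiffAt_fst
    exact ((h1.clm_apply contDiffAt_snd.fst).sub
      (contDiffAt_snd.snd.smul contDiffAt_snd.fst)).prodMk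
      (l.contDiff.contDiffAt.comp q₀ contDiffAt_snd.fst)
  have hder : ∀ w : (Fin n → ℝ) × ℝ, (fderiv ℝ F q₀ ∘L .inr ℝ (Fin n → ℝ) ((Fin n → ℝ) × ℝ)) w
      = (fderiv ℝ f u w.1 - lam i u • w.1 - w.2 • b i, l w.1) := by
    intro w
    have h1 : HasFDerivAt (fun p : (Fin n → ℝ) × ℝ => F (u, p))
        (fderiv ℝ F q₀ ∘L .inr ℝ (Fin n → ℝ) ((Fin n → ℝ) × ℝ)) (b i, lam i u) := by
      refine HasFDerivAt.comp (b i, lam i u) (g := F) ?_ (hasFDerivAt_prodMk_right u _)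
      exact (hF.differentiableAt (by norm_num)).hasFDerivAt
    have h2 : HasFDerivAt (fun p : (Fin n → ℝ) × ℝ => F (u, p)) _ (b i, lam i u) :=
      HasFDerivAt.prodMk
        (((fderiv ℝ f u).hasFDerivAt.comp _ hasFDerivAt_fst).sub
          (hasFDerivAt_snd.fun_smul hasFDerivAt_fst))
        (l.hasFDerivAt.comp _ hasFDerivAt_fst)
    rw [h1.unique h2]
    simp [sub_sub]
  have hinv : (fderiv ℝ F q₀ ∘L .inr ℝ (Fin n → ℝ) ((Fin n → ℝ) × ℝ)).IsInvertible := by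
    have hinj : Function.Injective
        ((fderiv ℝ F q₀ ∘L .inr ℝ (Fin n → ℝ) ((Fin n → ℝ) × ℝ) :
          ((Fin n → ℝ) × ℝ) →L[ℝ] ((Fin n → ℝ) × ℝ)) :
          ((Fin n → ℝ) × ℝ) →ₗ[ℝ] ((Fin n → ℝ) × ℝ)) := by
      rw [← LinearMap.ker_eq_bot, LinearMap.ker_eq_bot']
      intro w hw
      have hw' := (hder w).symm.trans hw
      rw [Prod.mk_eq_zero] at hw'
      obtain ⟨h1, h2⟩ := eigenpair_linearization_injective b
        (fderiv ℝ f u : (Fin n → ℝ) →ₗ[ℝ] (Fin n → ℝ)) (fun i => lam i u)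
        (hyp u hu).1.injective hb i hw'.1 hw'.2
      exact Prod.ext h1 h2
    exact ⟨(LinearEquiv.ofInjectiveEndo _ hinj).toContinuousLinearEquiv, by ext <;> rfl⟩
  set ψ := hF.implicitFunction (by norm_num) hinv with hψ
  have hψu : ψ u = (b i, lam i u) := hF.implicitFunction_apply_self (by norm_num) hinv
  have hψs : ContDiffAt ℝ 2 ψ u := hF.contDiffAt_implicitFunction (by norm_num) hinv
  refine ⟨fun x => (ψ x).1, fun x => (ψ x).2, hψs.fst, hψs.snd, by simp [hψu], by simp [hψu], ?_⟩
  filter_upwards [hF.eventually_apply_implicitFunction (by norm_num) hinv] with x hx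
  have h1 : fderiv ℝ f x (ψ x).1 - (ψ x).2 • (ψ x).1
      = fderiv ℝ f u (b i) - lam i u • b i := congrArg Prod.fst hx
  rwa [hb, sub_self, sub_eq_zero] at h1

/-- A frame of eigenvectors `r i` of the Jacobi matrix of `f` on the open set `V`, with the dual
coframe `l i` and with characteristic velocities `lam i`, all of class `C²`. -/
structure IsEigenframe (f : (Fin n → ℝ) → (Fin n → ℝ)) (lam : Fin n → (Fin n → ℝ) → ℝ)
    (V : Set (Fin n → ℝ)) (r : Fin n → (Fin n → ℝ) → (Fin n → ℝ))
    (l : Fin n → (Fin n → ℝ) → ((Fin n → ℝ) →L[ℝ] ℝ)) : Prop where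
  isOpen : IsOpen V
  contDiffOn_lam : ∀ i, ContDiffOn ℝ 2 (lam i) V
  contDiffOn_r : ∀ i, ContDiffOn ℝ 2 (r i) V
  contDiffOn_l : ∀ i, ContDiffOn ℝ 2 (l i) V
  eigen : ∀ x ∈ V, ∀ i, fderiv ℝ f x (r i x) = lam i x • r i x
  dual : ∀ x ∈ V, ∀ i j, l i x (r j x) = if i = j then 1 else 0

/-- Strictly increasing finite sequences are determined by their sets of values. -/
theorem strictMono_eq_of_forall_mem {a b : Fin n → ℝ} (ha : StrictMono a) (hb : StrictMono b)
    (h : ∀ i, ∃ j, b i = a j) : b = a := by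
  choose σ hσ using h
  have hmono : StrictMono σ := fun i j hij => ha.lt_iff_lt.1 (by rw [← hσ, ← hσ]; exact hb hij)
  have : σ = id := by
    have h1 : Function.Bijective σ := Finite.injective_iff_bijective.1 hmono.injective
    exact (hmono.range_inj strictMono_id).1 (by simp [h1.2.range_eq])
  funext i
  rw [hσ, this, id]

theorem IsStrictlyHyperbolic.exists_eigenframe (hU : IsOpen U) (hf : ContDiffOn ℝ ∞ f U)
    (hyp : IsStrictlyHyperbolic f U lam) (hu : u ∈ U) :
    ∃ V r l, u ∈ V ∧ V ⊆ U ∧ IsEigenframe f lam V r l := by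
  have hf1 : ContDiffAt ℝ 2 (fderiv ℝ f) u :=
    (hf.contDiffAt (hU.mem_nhds hu)).fderiv_right (by norm_cast)
  obtain ⟨b, hb⟩ := hyp.exists_eigenbasis hu
  choose r μ hr hμ hru hμu he using hyp.exists_smooth_eigenpair hu hf1 b hb
  -- `R x` maps the standard basis to the frame; the coframe is made of the rows of its inverse.
  let R : (Fin n → ℝ) → ((Fin n → ℝ) →L[ℝ] (Fin n → ℝ)) := fun x =>
    ∑ i, (ContinuousLinearMap.proj (R := ℝ) (φ := fun _ : Fin n => ℝ) i).smulRight (r i x)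
  have hRe : ∀ x j, R x (Pi.single j 1) = r j x := by
    intro x j
    simp [R, Pi.single_apply]
  have hR : ContDiffAt ℝ 2 R u := by
    refine ContDiffAt.sum fun i _ => ?_
    exact (ContinuousLinearMap.smulRightL ℝ (Fin n → ℝ) (Fin n → ℝ)
      (ContinuousLinearMap.proj i)).contDiff.contDiffAt.comp u (hr i)
  have hRu : IsUnit (R u) := by
    have h1 : R u = ((b.equivFun.symm.toContinuousLinearEquiv :
        (Fin n → ℝ) ≃L[ℝ] (Fin n → ℝ)) : (Fin n → ℝ) →L[ℝ] (Fin n → ℝ)) := by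
      ext v j
      simp [R, hru, Basis.equivFun_symm_apply]
    rw [h1]
    exact (ContinuousLinearEquiv.toUnit b.equivFun.symm.toContinuousLinearEquiv).isUnit
  have hRinv : ContDiffAt ℝ 2 (fun x => Ring.inverse (R x)) u := by
    obtain ⟨w, hw⟩ := hRu
    exact ContDiffAt.comp u (g := Ring.inverse) (hw ▸ contDiffAt_ringInverse ℝ w) hR
  let l : Fin n → (Fin n → ℝ) → ((Fin n → ℝ) →L[ℝ] ℝ) := fun i x =>
    (ContinuousLinearMap.proj (R := ℝ) (φ := fun _ : Fin n => ℝ) i) ∘L Ring.inverse (R x)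
  have hl : ∀ i, ContDiffAt ℝ 2 (l i) u := fun i => contDiffAt_const.clm_comp hRinv
  have hunit : ∀ᶠ x in 𝓝 u, IsUnit (R x) :=
    hR.continuousAt.eventually (Units.isOpen.mem_nhds hRu)
  have hmono : ∀ᶠ x in 𝓝 u, StrictMono (fun i => μ i x) := by
    have : ∀ i j : Fin n, i < j → ∀ᶠ x in 𝓝 u, μ i x < μ j x := fun i j hij =>
      (hμ i).continuousAt.eventually_lt (hμ j).continuousAt (by
        rw [hμu, hμu]; exact (hyp u hu).1 hij)
    have h2 : ∀ᶠ x in 𝓝 u, ∀ i j : Fin n, i < j → μ i x < μ j x := by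
      simp only [eventually_all]; exact this
    filter_upwards [h2] with x hx i j hij using hx i j hij
  have hdual : ∀ x, IsUnit (R x) → ∀ i j, l i x (r j x) = if i = j then 1 else 0 := by
    intro x hx i j
    have h1 : Ring.inverse (R x) (R x (Pi.single j 1)) = Pi.single j 1 := by
      have := Ring.inverse_mul_cancel (R x) hx
      exact congrArg (fun A : (Fin n → ℝ) →L[ℝ] (Fin n → ℝ) => A (Pi.single j 1)) this
    rw [hRe] at h1
    change Ring.inverse (R x) (r j x) i = _
    rw [h1, Pi.single_apply]
  have hlam : ∀ᶠ x in 𝓝 u, ∀ i, μ i x = lam i x := by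
    filter_upwards [hunit, hmono, eventually_all.2 he, hU.mem_nhds hu] with x h1 h2 h3 h4
    have : (fun i => μ i x) = fun i => lam i x := by
      refine strictMono_eq_of_forall_mem (hyp x h4).1 h2 fun i => ?_
      refine hyp.eigenvalue_eq h4 (v := r i x) (fun h0 => ?_) (h3 i)
      simpa [h0] using hdual x h1 i i
    exact fun i => congrFun this i
  have hlams : ∀ i, ContDiffAt ℝ 2 (lam i) u := fun i =>
    (hμ i).congr_of_eventuallyEq (hlam.mono fun x hx => (hx i).symm)
  have hall : ∀ᶠ x in 𝓝 u, x ∈ U ∧ IsUnit (R x) ∧ (∀ i, μ i x = lam i x) ∧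
      (∀ i, fderiv ℝ f x (r i x) = μ i x • r i x) ∧ (∀ i, ContDiffAt ℝ 2 (lam i) x) ∧
      (∀ i, ContDiffAt ℝ 2 (r i) x) ∧ ∀ i, ContDiffAt ℝ 2 (l i) x := by
    filter_upwards [hU.mem_nhds hu, hunit, hlam, eventually_all.2 he,
      eventually_all.2 fun i => (hlams i).eventually (by simp),
      eventually_all.2 fun i => (hr i).eventually (by simp),
      eventually_all.2 fun i => (hl i).eventually (by simp)] with x h1 h2 h3 h4 h5 h6 h7
    exact ⟨h1, h2, h3, h4, h5, h6, h7⟩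
  obtain ⟨V, hV, hVo, huV⟩ := mem_nhds_iff.1 hall
  refine ⟨V, r, l, huV, fun x hx => (hV hx).1, hVo,
    fun i x hx => ((hV hx).2.2.2.2.1 i).contDiffWithinAt,
    fun i x hx => ((hV hx).2.2.2.2.2.1 i).contDiffWithinAt,
    fun i x hx => ((hV hx).2.2.2.2.2.2 i).contDiffWithinAt, fun x hx i => ?_,
    fun x hx => hdual x (hV hx).2.1⟩
  rw [(hV hx).2.2.2.1, (hV hx).2.2.1]

theorem IsStrictlyHyperbolic.continuousOn_lam (hU : IsOpen U) (hf : ContDiffOn ℝ ∞ f U)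
    (hyp : IsStrictlyHyperbolic f U lam) (i : Fin n) : ContinuousOn (lam i) U := by
  intro x hx
  obtain ⟨V, r, l, hxV, -, hV⟩ := hyp.exists_eigenframe hU hf hx
  exact ((hV.contDiffOn_lam i).continuousOn.continuousAt
    (hV.isOpen.mem_nhds hxV)).continuousWithinAt

end Eigenframe

/-! ### Developable surfaces and rarefaction curves -/

section Developable

variable {n : ℕ} {f : (Fin n → ℝ) → (Fin n → ℝ)} {U : Set (Fin n → ℝ)}
  {lam : Fin n → (Fin n → ℝ) → ℝ} {I : Set ℝ} {γ : ℝ → (Fin n → ℝ)}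

/-- The embedding of `ℝⁿ` in the homogeneous coordinate space of `P^{n+1}` as the subspace
`Y = y^0 = 0`. -/
def infinityEmbedding (n : ℕ) : (Fin n → ℝ) →L[ℝ] (Fin (n + 2) → ℝ) :=
  LinearMap.toContinuousLinearMap
    { toFun := fun v => Matrix.vecCons 0 (Matrix.vecCons 0 v)
      map_add' := fun v w => by simp
      map_smul' := fun c v => by simp }

theorem infinityEmbedding_apply (v : Fin n → ℝ) :
    infinityEmbedding n v = Matrix.vecCons 0 (Matrix.vecCons 0 v) := rfl

theorem infinityEmbedding_zero_coord (v : Fin n → ℝ) : infinityEmbedding n v 0 = 0 := rfl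

theorem infinityEmbedding_one_coord (v : Fin n → ℝ) : infinityEmbedding n v 1 = 0 := rfl

theorem infinityEmbedding_injective : Function.Injective (infinityEmbedding n) := by
  intro v w h
  ext i
  simpa [infinityEmbedding_apply] using congrFun h i.succ.succ

theorem affinePoint_eq (p : Fin n → ℝ) :
    affinePoint p = affinePoint 0 - infinityEmbedding n p := by
  simp [affinePoint, infinityEmbedding_apply]

theorem pointAtInfinity_eq (u : Fin n → ℝ) :
    pointAtInfinity u = pointAtInfinity 0 + infinityEmbedding n u := by
  simp [pointAtInfinity, infinityEmbedding_apply]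

theorem affinePoint_zero_coord (p : Fin n → ℝ) : affinePoint p 0 = 1 := rfl

theorem affinePoint_one_coord (p : Fin n → ℝ) : affinePoint p 1 = 0 := rfl

theorem pointAtInfinity_zero_coord (u : Fin n → ℝ) : pointAtInfinity u 0 = 0 := rfl

theorem pointAtInfinity_one_coord (u : Fin n → ℝ) : pointAtInfinity u 1 = 1 := rfl

theorem eq_zero_of_combination_eq_zero {p u w : Fin n → ℝ} {a b : ℝ}
    (h : a • affinePoint p + b • pointAtInfinity u + infinityEmbedding n w = 0) :
    a = 0 ∧ b = 0 ∧ w = 0 := by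
  have ha : a = 0 := by
    simpa [affinePoint_zero_coord, pointAtInfinity_zero_coord, infinityEmbedding_zero_coord]
      using congrFun h 0
  have hb : b = 0 := by
    simpa [affinePoint_one_coord, pointAtInfinity_one_coord, infinityEmbedding_one_coord]
      using congrFun h 1
  refine ⟨ha, hb, infinityEmbedding_injective ?_⟩
  simpa [ha, hb] using h

theorem linearIndependent_line_and_pair {p u v w : Fin n → ℝ}
    (h : LinearIndependent ℝ ![v, w]) :
    LinearIndependent ℝ ![affinePoint p, pointAtInfinity u, infinityEmbedding n v,
      infinityEmbedding n w] := by
  rw [Fintype.linearIndependent_iff]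
  intro g hg
  simp only [Fin.sum_univ_four, Matrix.cons_val] at hg
  obtain ⟨h0, h1, h2⟩ := eq_zero_of_combination_eq_zero (p := p) (u := u) (a := g 0) (b := g 1)
    (w := g 2 • v + g 3 • w) (by rw [← hg, map_add, map_smul, map_smul]; abel)
  obtain ⟨h3, h4⟩ := LinearIndependent.pair_iff.1 h _ _ h2
  intro i
  fin_cases i <;> assumption

theorem finrank_tangentSpace_le_iff {p u v w : Fin n → ℝ} (hv : v ≠ 0) :
    finrank ℝ (Submodule.span ℝ ({affinePoint p, pointAtInfinity u, -infinityEmbedding n w,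
      infinityEmbedding n v} : Set (Fin (n + 2) → ℝ))) ≤ 3 ↔ ∃ μ : ℝ, w = μ • v := by
  constructor
  · intro h
    by_contra! hcon
    have hli : LinearIndependent ℝ ![-w, v] := by
      rw [LinearIndependent.pair_iff]
      intro s t hst
      have hs : s = 0 := by
        by_contra hs
        refine hcon (s⁻¹ * t) ?_
        have : s • w = t • v := by
          rw [smul_neg, neg_add_eq_zero] at hst
          exact hst
        rw [mul_smul, ← this, smul_smul, inv_mul_cancel₀ hs, one_smul]
      subst hs
      simpa [hv] using hst
    have h4 := finrank_span_eq_card (linearIndependent_line_and_pair (p := p) (u := u) hli)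
    have hr : Set.range ![affinePoint p, pointAtInfinity u, infinityEmbedding n (-w),
        infinityEmbedding n v] = {affinePoint p, pointAtInfinity u, -infinityEmbedding n w,
        infinityEmbedding n v} := by
      rw [map_neg]
      simp only [Matrix.range_cons, Matrix.range_empty, Set.union_empty, Set.singleton_union]
    rw [hr, Fintype.card_fin] at h4
    omega
  · rintro ⟨μ, rfl⟩
    refine le_trans (Submodule.finrank_mono (t := Submodule.span ℝ (Set.range
      ![affinePoint p, pointAtInfinity u, infinityEmbedding n v])) ?_)
      ((finrank_range_le_card _).trans (by simp))
    rw [Submodule.span_le]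
    have hmem : ∀ i, ![affinePoint p, pointAtInfinity u, infinityEmbedding n v] i ∈
        Submodule.span ℝ (Set.range
          ![affinePoint p, pointAtInfinity u, infinityEmbedding n v]) :=
      fun i => Submodule.subset_span ⟨i, rfl⟩
    rintro x (rfl | rfl | rfl | rfl)
    · exact hmem 0
    · exact hmem 1
    · rw [map_smul]
      exact neg_mem (Submodule.smul_mem _ _ (hmem 2))
    · exact hmem 2

theorem hasDerivAt_comp_curve (hU : IsOpen U) (hf : ContDiffOn ℝ ∞ f U) {t : ℝ}
    (ht : γ t ∈ U) (hγ : DifferentiableAt ℝ γ t) :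
    HasDerivAt (fun s => f (γ s)) (fderiv ℝ f (γ t) (deriv γ t)) t :=
  ((hf.differentiableOn (by simp)).differentiableAt
    (hU.mem_nhds ht)).hasFDerivAt.comp_hasDerivAt t hγ.hasDerivAt

theorem span_tangentSpace_eq (hU : IsOpen U) (hf : ContDiffOn ℝ ∞ f U) {t : ℝ}
    (ht : γ t ∈ U) (hγ : DifferentiableAt ℝ γ t) :
    ({affinePoint (f (γ t)), pointAtInfinity (γ t), deriv (fun s => affinePoint (f (γ s))) t,
      deriv (fun s => pointAtInfinity (γ s)) t} : Set (Fin (n + 2) → ℝ)) =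
    {affinePoint (f (γ t)), pointAtInfinity (γ t),
      -infinityEmbedding n (fderiv ℝ f (γ t) (deriv γ t)), infinityEmbedding n (deriv γ t)} := by
  have h1 : HasDerivAt (fun s => affinePoint (f (γ s)))
      (-infinityEmbedding n (fderiv ℝ f (γ t) (deriv γ t))) t := by
    have := ((infinityEmbedding n).hasFDerivAt.comp_hasDerivAt t
      (hasDerivAt_comp_curve hU hf ht hγ)).const_sub (affinePoint 0)
    exact this.congr_of_eventuallyEq (.of_forall fun s => affinePoint_eq _)
  have h2 : HasDerivAt (fun s => pointAtInfinity (γ s)) (infinityEmbedding n (deriv γ t)) t := by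
    have := ((infinityEmbedding n).hasFDerivAt.comp_hasDerivAt t
      hγ.hasDerivAt).const_add (pointAtInfinity 0)
    exact this.congr_of_eventuallyEq (.of_forall fun s => pointAtInfinity_eq _)
  rw [h1.deriv, h2.deriv]

theorem IsRarefactionCurve.isDevelopableAlong (hU : IsOpen U) (hf : ContDiffOn ℝ ∞ f U)
    {i : Fin n} (h : IsRarefactionCurve f U lam i I γ) : IsDevelopableAlong f U I γ where
  isOpen := h.isOpen
  ordConnected := h.ordConnected
  mem := h.mem
  contDiffOn := h.contDiffOn
  velocity_ne_zero := h.velocity_ne_zero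
  finrank_le := fun t ht => by
    rw [span_tangentSpace_eq hU hf (h.mem t ht) ((h.contDiffOn.differentiableOn
      (by simp)).differentiableAt (h.isOpen.mem_nhds ht)),
      finrank_tangentSpace_le_iff (h.velocity_ne_zero t ht)]
    exact ⟨_, h.eigenvector t ht⟩

/-- Along a developable surface the family of the eigenvector `γ'` cannot jump, because the
characteristic velocities are continuous and distinct. -/
theorem IsDevelopableAlong.exists_isRarefactionCurve (hU : IsOpen U) (hf : ContDiffOn ℝ ∞ f U)
    (hyp : IsStrictlyHyperbolic f U lam) (h : IsDevelopableAlong f U I γ) (hI : I.Nonempty) :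
    ∃ i, IsRarefactionCurve f U lam i I γ := by
  have hex : ∀ t ∈ I, ∃ i, fderiv ℝ f (γ t) (deriv γ t) = lam i (γ t) • deriv γ t := by
    intro t ht
    have h1 := h.finrank_le t ht
    rw [span_tangentSpace_eq hU hf (h.mem t ht) ((h.contDiffOn.differentiableOn
      (by simp)).differentiableAt (h.isOpen.mem_nhds ht)),
      finrank_tangentSpace_le_iff (h.velocity_ne_zero t ht)] at h1
    obtain ⟨μ, hμ⟩ := h1
    obtain ⟨i, rfl⟩ := hyp.eigenvalue_eq (h.mem t ht) (h.velocity_ne_zero t ht) hμ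
    exact ⟨i, hμ⟩
  have hγ' : ContinuousOn (deriv γ) I := h.contDiffOn.continuousOn_deriv_of_isOpen h.isOpen le_rfl
  have hdef : ∀ i, ContinuousOn
      (fun t => fderiv ℝ f (γ t) (deriv γ t) - lam i (γ t) • deriv γ t) I := fun i =>
    (((hf.continuousOn_fderiv_of_isOpen hU (by simp)).comp h.contDiffOn.continuousOn
      h.mem).clm_apply hγ').sub
      (((hyp.continuousOn_lam hU hf i).comp h.contDiffOn.continuousOn h.mem).smul hγ')
  obtain ⟨t₀, ht₀⟩ := hI
  obtain ⟨i, hi⟩ := hex t₀ ht₀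
  let s : Set ℝ := {t ∈ I | fderiv ℝ f (γ t) (deriv γ t) - lam i (γ t) • deriv γ t = 0}
  have hs : IsOpen s := by
    rw [isOpen_iff_mem_nhds]
    rintro t ⟨ht, hts⟩
    have hne : ∀ j, j ≠ i → ∀ᶠ t' in 𝓝 t,
        fderiv ℝ f (γ t') (deriv γ t') - lam j (γ t') • deriv γ t' ≠ 0 := by
      intro j hj
      refine ((hdef j).continuousAt (h.isOpen.mem_nhds ht)).eventually_ne ?_
      rw [sub_eq_zero.1 hts, ← sub_smul]
      exact smul_ne_zero (sub_ne_zero.2 ((hyp _ (h.mem t ht)).1.injective.ne hj.symm))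
        (h.velocity_ne_zero t ht)
    have hne' : ∀ᶠ t' in 𝓝 t, ∀ j, j ≠ i →
        fderiv ℝ f (γ t') (deriv γ t') - lam j (γ t') • deriv γ t' ≠ 0 := by
      rw [eventually_all]
      intro j
      by_cases hj : j = i
      · simp [hj]
      · filter_upwards [hne j hj] with t' h1 _ using h1
    filter_upwards [hne', h.isOpen.mem_nhds ht] with t' h1 h2
    obtain ⟨j, hj⟩ := hex t' h2
    by_cases hji : j = i
    · subst hji; exact ⟨h2, sub_eq_zero.2 hj⟩
    · exact absurd (sub_eq_zero.2 hj) (h1 j hji)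
  have hsub : I ⊆ s := by
    refine h.ordConnected.isPreconnected.subset_of_closure_inter_subset hs
      ⟨t₀, ht₀, ht₀, sub_eq_zero.2 hi⟩ ?_
    rintro t ⟨htc, ht⟩
    refine ⟨ht, ?_⟩
    have h1 : (𝓝[s] t).NeBot := mem_closure_iff_nhdsWithin_neBot.1 htc
    have h2 : Tendsto (fun t => fderiv ℝ f (γ t) (deriv γ t) - lam i (γ t) • deriv γ t) (𝓝[s] t)
        (𝓝 (fderiv ℝ f (γ t) (deriv γ t) - lam i (γ t) • deriv γ t)) :=
      ((hdef i).continuousAt (h.isOpen.mem_nhds ht)).tendsto.mono_left nhdsWithin_le_nhds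
    refine tendsto_nhds_unique h2 (tendsto_const_nhds.congr' ?_)
    filter_upwards [self_mem_nhdsWithin] with t' ht' using ht'.2.symm
  exact ⟨i, h.isOpen, h.ordConnected, h.mem, h.contDiffOn, h.velocity_ne_zero,
    fun t ht => sub_eq_zero.1 (hsub ht).2⟩

/-- On an interval carrying a curve with nonzero velocity, a curve is not constant. -/
theorem exists_curve_ne (hI : IsOpen I) (hγ' : ∀ t ∈ I, deriv γ t ≠ 0) {t₀ : ℝ} (ht₀ : t₀ ∈ I)
    (q : Fin n → ℝ) : ∃ t ∈ I, γ t ≠ q := by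
  by_contra! hcon
  refine hγ' t₀ ht₀ ?_
  have : γ =ᶠ[𝓝 t₀] fun _ => q := by
    filter_upwards [hI.mem_nhds ht₀] with t ht using hcon t ht
  rw [this.deriv_eq, deriv_const]

/-- If the characteristic velocity has the value `c` along a rarefaction curve, then `f - c u` is
constant along it; this constant determines the common point of the lines. -/
theorem IsRarefactionCurve.exists_map_eq (hU : IsOpen U) (hf : ContDiffOn ℝ ∞ f U) {i : Fin n}
    (h : IsRarefactionCurve f U lam i I γ) (hI : I.Nonempty) {c : ℝ}
    (hc : ∀ t ∈ I, lam i (γ t) = c) : ∃ q, ∀ t ∈ I, f (γ t) = c • γ t + q := by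
  obtain ⟨t₀, ht₀⟩ := hI
  have hd : ∀ t ∈ I, HasDerivAt (fun s => f (γ s) - c • γ s) 0 t := by
    intro t ht
    have hγ : DifferentiableAt ℝ γ t := (h.contDiffOn.differentiableOn
      (by simp)).differentiableAt (h.isOpen.mem_nhds ht)
    have := (hasDerivAt_comp_curve hU hf (h.mem t ht) hγ).sub (hγ.hasDerivAt.const_smul c)
    rwa [h.eigenvector t ht, hc t ht, sub_self] at this
  refine ⟨f (γ t₀) - c • γ t₀, fun t ht => ?_⟩
  have := h.isOpen.is_const_of_deriv_eq_zero h.ordConnected.isPreconnected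
    (fun t ht => (hd t ht).differentiableAt.differentiableWithinAt)
    (fun t ht => (hd t ht).deriv) ht ht₀
  rw [← this]; abel

theorem IsTSystem.developablesArePlanarPencils (hU : IsOpen U) (hf : ContDiffOn ℝ ∞ f U)
    (hyp : IsStrictlyHyperbolic f U lam) (hT : IsTSystem f U lam) (hn : 0 < n) :
    DevelopablesArePlanarPencils f U := by
  intro I γ hdev
  suffices hs : ∃ (c : ℝ) (q p v : Fin n → ℝ), v ≠ 0 ∧ ∀ t ∈ I, f (γ t) = c • γ t + q ∧
      ∃ s : ℝ, γ t = p + s • v by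
    obtain ⟨c, q, p, v, hv, h⟩ := hs
    have hli : LinearIndependent ℝ ![affinePoint q + c • pointAtInfinity 0, pointAtInfinity p,
        infinityEmbedding n v] := by
      rw [Fintype.linearIndependent_iff]
      intro g hg
      simp only [Fin.sum_univ_three, Matrix.cons_val] at hg
      obtain ⟨h0, h1, h2⟩ := eq_zero_of_combination_eq_zero (p := q) (u := p) (a := g 0)
        (b := g 1 + g 0 * c) (w := g 2 • v - (g 0 * c) • p) (by
          rw [← hg, pointAtInfinity_eq p, map_sub, map_smul, map_smul]; module)
      have h3 : g 1 = 0 := by simpa [h0] using h1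
      have h4 : g 2 = 0 := by simpa [h0, hv] using h2
      intro i
      fin_cases i <;> assumption
    refine ⟨Submodule.span ℝ {affinePoint q + c • pointAtInfinity 0}, Submodule.span ℝ (Set.range
      ![affinePoint q + c • pointAtInfinity 0, pointAtInfinity p, infinityEmbedding n v]),
      finrank_span_singleton (hli.ne_zero 0), by rw [finrank_span_eq_card hli]; simp,
      fun t ht => ?_⟩
    obtain ⟨hft, s, hs⟩ := h t ht
    have hvertex : affinePoint q + c • pointAtInfinity 0
        = affinePoint (f (γ t)) + c • pointAtInfinity (γ t) := by
      rw [hft, affinePoint_eq q, affinePoint_eq (c • γ t + q), pointAtInfinity_eq (γ t),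
        map_add, map_smul]
      module
    have hmem : ∀ i, ![affinePoint q + c • pointAtInfinity 0, pointAtInfinity p,
        infinityEmbedding n v] i ∈ Submodule.span ℝ (Set.range
          ![affinePoint q + c • pointAtInfinity 0, pointAtInfinity p, infinityEmbedding n v]) :=
      fun i => Submodule.subset_span ⟨i, rfl⟩
    have hB : pointAtInfinity (γ t) ∈ Submodule.span ℝ (Set.range
        ![affinePoint q + c • pointAtInfinity 0, pointAtInfinity p, infinityEmbedding n v]) := by
      have : pointAtInfinity (γ t) = pointAtInfinity p + s • infinityEmbedding n v := by
        rw [hs, pointAtInfinity_eq, map_add, map_smul, pointAtInfinity_eq p]; abel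
      rw [this]
      exact add_mem (hmem 1) (Submodule.smul_mem _ _ (hmem 2))
    constructor
    · rw [Submodule.span_le, Set.singleton_subset_iff, hvertex]
      exact add_mem (Submodule.subset_span (by simp))
        (Submodule.smul_mem _ _ (Submodule.subset_span (by simp)))
    · rw [projLine, Submodule.span_le]
      rintro x (rfl | rfl)
      · have : affinePoint (f (γ t)) = (affinePoint q + c • pointAtInfinity 0)
            - c • pointAtInfinity (γ t) := by rw [hvertex]; abel
        rw [this]
        exact sub_mem (hmem 0) (Submodule.smul_mem _ _ hB)
      · exact hB
  rcases I.eq_empty_or_nonempty with rfl | hI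
  · exact ⟨0, 0, 0, fun _ => 1, fun h => one_ne_zero (congrFun h ⟨0, hn⟩), by simp⟩
  obtain ⟨i, hi⟩ := hdev.exists_isRarefactionCurve hU hf hyp hI
  obtain ⟨c, hc⟩ := hT.linearlyDegenerate i I γ hi
  obtain ⟨p, v, hpv⟩ := hT.straight i I γ hi
  obtain ⟨q, hq⟩ := hi.exists_map_eq hU hf hI hc
  refine ⟨c, q, p, v, ?_, fun t ht => ⟨hq t ht, hpv t ht⟩⟩
  rintro rfl
  obtain ⟨t₀, ht₀⟩ := hI
  obtain ⟨t, ht, hne⟩ := exists_curve_ne hi.isOpen hi.velocity_ne_zero ht₀ p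
  obtain ⟨s, hs⟩ := hpv t ht
  exact hne (by simpa using hs)

theorem DevelopablesArePlanarPencils.isTSystem (hU : IsOpen U) (hf : ContDiffOn ℝ ∞ f U)
    (hP : DevelopablesArePlanarPencils f U) : IsTSystem f U lam where
  straight := by
    intro i I γ h
    rcases I.eq_empty_or_nonempty with rfl | ⟨t₀, ht₀⟩
    · exact ⟨0, 0, by simp⟩
    obtain ⟨vertex, plane, -, hplane, hvp⟩ := hP I γ (h.isDevelopableAlong hU hf)
    obtain ⟨t₁, ht₁, hne⟩ := exists_curve_ne h.isOpen h.velocity_ne_zero ht₀ (γ t₀)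
    refine ⟨γ t₀, γ t₁ - γ t₀, fun t ht => ?_⟩
    have hA : ∀ t ∈ I, affinePoint (f (γ t)) ∈ plane := fun t ht =>
      (hvp t ht).2 (Submodule.subset_span (by simp))
    have hB : ∀ t ∈ I, pointAtInfinity (γ t) ∈ plane := fun t ht =>
      (hvp t ht).2 (Submodule.subset_span (by simp))
    have hJ : ∀ t ∈ I, infinityEmbedding n (γ t - γ t₀) ∈ plane := by
      intro t ht
      have := sub_mem (hB t ht) (hB t₀ ht₀)
      rwa [pointAtInfinity_eq, pointAtInfinity_eq (γ t₀), add_sub_add_left_eq_sub,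
        ← map_sub] at this
    have hdep : ¬ LinearIndependent ℝ ![γ t₁ - γ t₀, γ t - γ t₀] := by
      intro hli
      have h4 := finrank_span_eq_card
        (linearIndependent_line_and_pair (p := f (γ t₀)) (u := γ t₀) hli)
      have hle := Submodule.finrank_mono (s := Submodule.span ℝ (Set.range
        ![affinePoint (f (γ t₀)), pointAtInfinity (γ t₀), infinityEmbedding n (γ t₁ - γ t₀),
          infinityEmbedding n (γ t - γ t₀)])) (t := plane) (by
        rw [Submodule.span_le]
        rintro x ⟨j, rfl⟩
        fin_cases j
        · exact hA t₀ ht₀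
        · exact hB t₀ ht₀
        · exact hJ t₁ ht₁
        · exact hJ t ht)
      rw [h4, hplane, Fintype.card_fin] at hle
      omega
    rw [LinearIndependent.pair_iff' (sub_ne_zero.2 hne)] at hdep
    push Not at hdep
    obtain ⟨a, ha⟩ := hdep
    exact ⟨a, by rw [ha]; abel⟩
  linearlyDegenerate := by
    intro i I γ h
    rcases I.eq_empty_or_nonempty with rfl | ⟨t₀, ht₀⟩
    · exact ⟨0, by simp⟩
    obtain ⟨vertex, plane, hvertex, -, hvp⟩ := hP I γ (h.isDevelopableAlong hU hf)
    obtain ⟨x, hx, -⟩ := finrank_eq_one_iff'.1 hvertex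
    have hx0 : (x : Fin (n + 2) → ℝ) ≠ 0 := by simpa using hx
    -- The vertex lies on each line, with the same two homogeneous coordinates `Y` and `y^0`.
    have hcoord : ∀ t ∈ I, (x : Fin (n + 2) → ℝ) = (x : Fin (n + 2) → ℝ) 0 • affinePoint (f (γ t))
        + (x : Fin (n + 2) → ℝ) 1 • pointAtInfinity (γ t) := by
      intro t ht
      have h1 := (hvp t ht).1 x.2
      rw [projLine, Submodule.mem_span_pair] at h1
      obtain ⟨a, b, hab⟩ := h1
      rw [← hab]
      simp [affinePoint_zero_coord, pointAtInfinity_zero_coord, affinePoint_one_coord,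
        pointAtInfinity_one_coord]
    have hconst : ∀ t ∈ I, (x : Fin (n + 2) → ℝ) 0 • (f (γ t) - f (γ t₀))
        = (x : Fin (n + 2) → ℝ) 1 • (γ t - γ t₀) := by
      intro t ht
      have h1 := (hcoord t ht).symm.trans (hcoord t₀ ht₀)
      rw [affinePoint_eq, affinePoint_eq (f (γ t₀)), pointAtInfinity_eq,
        pointAtInfinity_eq (γ t₀), ← sub_eq_zero] at h1
      refine infinityEmbedding_injective ?_
      rw [map_smul, map_smul, map_sub, map_sub, ← sub_eq_zero, ← neg_eq_zero, ← h1]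
      module
    have ha : (x : Fin (n + 2) → ℝ) 0 ≠ 0 := by
      intro ha
      have hb : (x : Fin (n + 2) → ℝ) 1 ≠ 0 := by
        intro hb
        exact hx0 (by rw [hcoord t₀ ht₀, ha, hb]; simp)
      obtain ⟨t, ht, hne⟩ := exists_curve_ne h.isOpen h.velocity_ne_zero ht₀ (γ t₀)
      have h1 := hconst t ht
      rw [ha, zero_smul] at h1
      exact smul_ne_zero hb (sub_ne_zero.2 hne) h1.symm
    refine ⟨(x : Fin (n + 2) → ℝ) 1 / (x : Fin (n + 2) → ℝ) 0, fun t ht => ?_⟩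
    have hγ : DifferentiableAt ℝ γ t := (h.contDiffOn.differentiableOn
      (by simp)).differentiableAt (h.isOpen.mem_nhds ht)
    have hd1 := ((hasDerivAt_comp_curve hU hf (h.mem t ht) hγ).sub_const
      (f (γ t₀))).const_smul ((x : Fin (n + 2) → ℝ) 0)
    have hd2 := (hγ.hasDerivAt.sub_const (γ t₀)).const_smul ((x : Fin (n + 2) → ℝ) 1)
    have heq : (fun s => (x : Fin (n + 2) → ℝ) 1 • (γ s - γ t₀)) =ᶠ[𝓝 t]
        fun s => (x : Fin (n + 2) → ℝ) 0 • (f (γ s) - f (γ t₀)) := by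
      filter_upwards [h.isOpen.mem_nhds ht] with s hs using (hconst s hs).symm
    have h1 := hd1.unique (hd2.congr_of_eventuallyEq heq.symm)
    rw [h.eigenvector t ht, smul_smul] at h1
    have h2 := smul_left_injective ℝ (h.velocity_ne_zero t ht) h1
    field_simp
    linarith

end Developable

/-! ### The second derivative of a T-system on eigenvectors -/

section SecondDerivative

variable {n : ℕ} {f : (Fin n → ℝ) → (Fin n → ℝ)} {U V : Set (Fin n → ℝ)}
  {lam : Fin n → (Fin n → ℝ) → ℝ} {r : Fin n → (Fin n → ℝ) → (Fin n → ℝ)}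
  {l : Fin n → (Fin n → ℝ) → ((Fin n → ℝ) →L[ℝ] ℝ)} {x : Fin n → ℝ}

theorem IsEigenframe.r_ne_zero (hV : IsEigenframe f lam V r l) (hx : x ∈ V) (i : Fin n) :
    r i x ≠ 0 := fun h => by simpa [h] using hV.dual x hx i i

theorem IsEigenframe.contDiffAt_r (hV : IsEigenframe f lam V r l) (hx : x ∈ V) (i : Fin n) :
    ContDiffAt ℝ 2 (r i) x := (hV.contDiffOn_r i).contDiffAt (hV.isOpen.mem_nhds hx)

theorem IsEigenframe.contDiffAt_l (hV : IsEigenframe f lam V r l) (hx : x ∈ V) (i : Fin n) :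
    ContDiffAt ℝ 2 (l i) x := (hV.contDiffOn_l i).contDiffAt (hV.isOpen.mem_nhds hx)

theorem IsEigenframe.differentiableAt_r (hV : IsEigenframe f lam V r l) (hx : x ∈ V)
    (i : Fin n) : DifferentiableAt ℝ (r i) x := (hV.contDiffAt_r hx i).differentiableAt (by simp)

theorem IsEigenframe.exists_isRarefactionCurve (hV : IsEigenframe f lam V r l) (hVU : V ⊆ U)
    (hx : x ∈ V) (i : Fin n) :
    ∃ (ε : ℝ) (γ : ℝ → (Fin n → ℝ)), 0 < ε ∧ γ 0 = x ∧
      IsRarefactionCurve f U lam i (Set.Ioo (-ε) ε) γ ∧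
      ∀ t ∈ Set.Ioo (-ε) ε, γ t ∈ V ∧ HasDerivAt γ (r i (γ t)) t := by
  obtain ⟨γ, hγ0, ε₁, hε₁, hγ⟩ := ((hV.contDiffAt_r hx i).of_le
    one_le_two).exists_forall_mem_closedBall_exists_eq_forall_mem_Ioo_hasDerivAt₀ 0
  rw [zero_sub, zero_add] at hγ
  have hcont : ContinuousAt γ 0 := (hγ 0 ⟨by linarith, hε₁⟩).continuousAt
  obtain ⟨ε₂, hε₂, hball⟩ := Metric.eventually_nhds_iff.1
    (hcont.eventually (hV.isOpen.mem_nhds (by rwa [hγ0])))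
  have h : ∀ t ∈ Set.Ioo (-min ε₁ ε₂) (min ε₁ ε₂), γ t ∈ V ∧ HasDerivAt γ (r i (γ t)) t := by
    rintro t ⟨ht1, ht2⟩
    have h1 := min_le_left ε₁ ε₂
    have h2 := min_le_right ε₁ ε₂
    refine ⟨hball ?_, hγ t ⟨by linarith, by linarith⟩⟩
    rw [Real.dist_eq, sub_zero, abs_lt]
    exact ⟨by linarith, by linarith⟩
  refine ⟨min ε₁ ε₂, γ, lt_min hε₁ hε₂, hγ0, ?_, h⟩
  have hγc : ContinuousOn γ (Set.Ioo (-min ε₁ ε₂) (min ε₁ ε₂)) := fun t ht =>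
    (h t ht).2.continuousAt.continuousWithinAt
  refine ⟨isOpen_Ioo, Set.ordConnected_Ioo, fun t ht => hVU (h t ht).1, ?_, fun t ht => ?_,
    fun t ht => ?_⟩
  · rw [show (1 : WithTop ℕ∞) = 0 + 1 from rfl, contDiffOn_succ_iff_deriv_of_isOpen isOpen_Ioo]
    refine ⟨fun t ht => (h t ht).2.differentiableAt.differentiableWithinAt, by simp, ?_⟩
    rw [contDiffOn_zero]
    exact ((hV.contDiffOn_r i).continuousOn.comp hγc fun t ht => (h t ht).1).congr
      fun t ht => (h t ht).2.deriv
  · rw [(h t ht).2.deriv]; exact hV.r_ne_zero (h t ht).1 i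
  · rw [(h t ht).2.deriv]; exact hV.eigen _ (h t ht).1 i

/-- The velocity of a curve on a straight line is parallel to the line. -/
theorem deriv_mem_span_of_mem_line {γ : ℝ → (Fin n → ℝ)} {I : Set ℝ} (hI : IsOpen I)
    {p v w : Fin n → ℝ} (h : ∀ t ∈ I, ∃ s : ℝ, γ t = p + s • v) {t : ℝ} (ht : t ∈ I)
    (hγ : HasDerivAt γ w t) : ∃ a : ℝ, w = a • v := by
  have hmem : w ∈ Submodule.span ℝ {v} := by
    refine (Submodule.span ℝ {v}).closed_of_finiteDimensional.mem_of_tendsto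
      (hasDerivAt_iff_tendsto_slope.1 hγ) ?_
    filter_upwards [nhdsWithin_le_nhds (hI.mem_nhds ht)] with t' ht'
    obtain ⟨s, hs⟩ := h t ht
    obtain ⟨s', hs'⟩ := h t' ht'
    refine Submodule.smul_mem _ _ (Submodule.mem_span_singleton.2 ⟨s' - s, ?_⟩)
    rw [vsub_eq_sub, hs, hs']
    module
  obtain ⟨a, ha⟩ := Submodule.mem_span_singleton.1 hmem
  exact ⟨a, ha.symm⟩

/-- Along a straight rarefaction curve with constant characteristic velocity `c`, the Jacobi matrix
has a fixed eigenvector with the fixed eigenvalue `c`; differentiate this along the curve. -/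
theorem IsTSystem.fderiv_fderiv_eigenvector (hU : IsOpen U) (hf : ContDiffOn ℝ ∞ f U)
    (hT : IsTSystem f U lam) (hV : IsEigenframe f lam V r l) (hVU : V ⊆ U) (hx : x ∈ V)
    (i : Fin n) : fderiv ℝ (fderiv ℝ f) x (r i x) (r i x) = 0 := by
  obtain ⟨ε, γ, hε, hγ0, hγ, hγV⟩ := hV.exists_isRarefactionCurve hVU hx i
  have h0 : (0 : ℝ) ∈ Set.Ioo (-ε) ε := ⟨by linarith, hε⟩
  obtain ⟨c, hc⟩ := hT.linearlyDegenerate i _ γ hγ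
  obtain ⟨p, v, hpv⟩ := hT.straight i _ γ hγ
  obtain ⟨a, ha⟩ := deriv_mem_span_of_mem_line isOpen_Ioo hpv h0 (hγV 0 h0).2
  rw [hγ0] at ha
  have hfix : ∀ t ∈ Set.Ioo (-ε) ε, fderiv ℝ f (γ t) (r i x) = c • r i x := by
    intro t ht
    obtain ⟨b, hb⟩ := deriv_mem_span_of_mem_line isOpen_Ioo hpv ht (hγV t ht).2
    have hb0 : b ≠ 0 := by
      rintro rfl
      exact hV.r_ne_zero (hγV t ht).1 i (by simpa using hb)
    have h1 := hV.eigen _ (hγV t ht).1 i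
    rw [hb, hc t ht, map_smul, smul_comm c b v] at h1
    rw [ha, map_smul, smul_right_injective _ hb0 h1, smul_comm]
  have hd : HasDerivAt (fun t => fderiv ℝ f (γ t) (r i x))
      (fderiv ℝ (fderiv ℝ f) x (r i x) (r i x)) 0 := by
    have h1 : HasFDerivAt (fderiv ℝ f) (fderiv ℝ (fderiv ℝ f) (γ 0)) (γ 0) := by
      have : ContDiffAt ℝ 1 (fderiv ℝ f) (γ 0) :=
        (hf.contDiffAt (hU.mem_nhds (hVU (hγV 0 h0).1))).fderiv_right (by norm_cast)
      exact (this.differentiableAt (by simp)).hasFDerivAt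
    have h2 := (h1.comp_hasDerivAt 0 (hγV 0 h0).2).clm_apply (hasDerivAt_const 0 (r i x))
    rw [hγ0] at h2
    simpa using h2
  refine hd.unique ((hasDerivAt_const (0 : ℝ) (c • r i x)).congr_of_eventuallyEq ?_)
  filter_upwards [isOpen_Ioo.mem_nhds h0] with t ht using hfix t ht

end SecondDerivative

/-! ### Higher derivatives -/

section HigherDerivatives

variable {E F : Type*} [NormedAddCommGroup E] [NormedSpace ℝ E] [NormedAddCommGroup F]
  [NormedSpace ℝ F] {V : Set E} {f : E → F} {x : E}

theorem ContDiffOn.fderiv_infty (hf : ContDiffOn ℝ ∞ f V) (hV : IsOpen V) :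
    ContDiffOn ℝ ∞ (fderiv ℝ f) V := hf.fderiv_of_isOpen hV (by simp)

theorem ContDiffOn.differentiableAt_infty (hf : ContDiffOn ℝ ∞ f V) (hV : IsOpen V)
    (hx : x ∈ V) : DifferentiableAt ℝ f x :=
  (hf.differentiableOn (by simp)).differentiableAt (hV.mem_nhds hx)

theorem fderiv_fderiv_comm (hf : ContDiffOn ℝ ∞ f V) (hV : IsOpen V) (hx : x ∈ V) (a b : E) :
    fderiv ℝ (fderiv ℝ f) x a b = fderiv ℝ (fderiv ℝ f) x b a :=
  (hf.contDiffAt (hV.mem_nhds hx)).isSymmSndFDerivAt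
    (by simp only [minSmoothness_of_isRCLikeNormedField]; norm_cast) a b

variable {B : E → E →L[ℝ] E →L[ℝ] F} {ρ σ : E → E}

theorem hasFDerivAt_bilinear (hB : DifferentiableAt ℝ B x) (hρ : DifferentiableAt ℝ ρ x)
    (hσ : DifferentiableAt ℝ σ x) (a : E) :
    ∃ L : E →L[ℝ] F, HasFDerivAt (fun y => B y (ρ y) (σ y)) L x ∧
      L a = fderiv ℝ B x a (ρ x) (σ x) + B x (fderiv ℝ ρ x a) (σ x)
        + B x (ρ x) (fderiv ℝ σ x a) := by
  refine ⟨_, (hB.hasFDerivAt.clm_apply hρ.hasFDerivAt).clm_apply hσ.hasFDerivAt, ?_⟩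
  simp
  abel

/-- The Leibniz rule for an identically vanishing contraction `B(ρ, σ)`. -/
theorem leibniz_of_bilinear_eq_zero (hB : DifferentiableAt ℝ B x) (hρ : DifferentiableAt ℝ ρ x)
    (hσ : DifferentiableAt ℝ σ x) (h : ∀ᶠ y in 𝓝 x, B y (ρ y) (σ y) = 0) (a : E) :
    fderiv ℝ B x a (ρ x) (σ x) + B x (fderiv ℝ ρ x a) (σ x) + B x (ρ x) (fderiv ℝ σ x a) = 0 := by
  obtain ⟨L, hL, hLa⟩ := hasFDerivAt_bilinear hB hρ hσ a
  rw [← hLa, hL.unique ((hasFDerivAt_const (0 : F) x).congr_of_eventuallyEq h)]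
  rfl

theorem fderiv_bilinear_symm (hV : IsOpen V) (hB : ContDiffOn ℝ ∞ B V)
    (h : ∀ y ∈ V, ∀ a b, B y a b = B y b a) (hx : x ∈ V) (a b c : E) :
    fderiv ℝ B x a b c = fderiv ℝ B x a c b := by
  have hBx := hB.differentiableAt_infty hV hx
  obtain ⟨L, hL, hLa⟩ := hasFDerivAt_bilinear (ρ := fun _ => b) (σ := fun _ => c) hBx
    (differentiableAt_const b) (differentiableAt_const c) a
  obtain ⟨M, hM, hMa⟩ := hasFDerivAt_bilinear (ρ := fun _ => c) (σ := fun _ => b) hBx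
    (differentiableAt_const c) (differentiableAt_const b) a
  have : L = M := hL.unique (hM.congr_of_eventuallyEq (by
    filter_upwards [hV.mem_nhds hx] with y hy using h y hy b c))
  subst this
  simpa using hLa.symm.trans hMa

theorem thirdFDeriv_comm_left (hf : ContDiffOn ℝ ∞ f V) (hV : IsOpen V) (hx : x ∈ V)
    (a b c : E) : fderiv ℝ (fderiv ℝ (fderiv ℝ f)) x a b c
      = fderiv ℝ (fderiv ℝ (fderiv ℝ f)) x b a c := by
  rw [fderiv_fderiv_comm (hf.fderiv_infty hV) hV hx]

theorem thirdFDeriv_comm_right (hf : ContDiffOn ℝ ∞ f V) (hV : IsOpen V) (hx : x ∈ V)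
    (a b c : E) : fderiv ℝ (fderiv ℝ (fderiv ℝ f)) x a b c
      = fderiv ℝ (fderiv ℝ (fderiv ℝ f)) x a c b :=
  fderiv_bilinear_symm hV ((hf.fderiv_infty hV).fderiv_infty hV)
    (fun _ hy => fderiv_fderiv_comm hf hV hy) hx a b c

/-- `D⁴f(a, a, b, b) = D⁴f(b, b, a, a)`. -/
theorem fourthFDeriv_swap (hf : ContDiffOn ℝ ∞ f V) (hV : IsOpen V) (hx : x ∈ V) (a b : E) :
    fderiv ℝ (fderiv ℝ (fderiv ℝ (fderiv ℝ f))) x a a b b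
      = fderiv ℝ (fderiv ℝ (fderiv ℝ (fderiv ℝ f))) x b b a a := by
  have hleft : ∀ a b c d, fderiv ℝ (fderiv ℝ (fderiv ℝ (fderiv ℝ f))) x a b c d
      = fderiv ℝ (fderiv ℝ (fderiv ℝ (fderiv ℝ f))) x b a c d := fun a b c d => by
    rw [thirdFDeriv_comm_left (hf.fderiv_infty hV) hV hx]
  have hmid : ∀ a b c d, fderiv ℝ (fderiv ℝ (fderiv ℝ (fderiv ℝ f))) x a b c d
      = fderiv ℝ (fderiv ℝ (fderiv ℝ (fderiv ℝ f))) x a c b d := fun a b c d => by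
    rw [thirdFDeriv_comm_right (hf.fderiv_infty hV) hV hx]
  have hright : ∀ a b c d, fderiv ℝ (fderiv ℝ (fderiv ℝ (fderiv ℝ f))) x a b c d
      = fderiv ℝ (fderiv ℝ (fderiv ℝ (fderiv ℝ f))) x a b d c := fun a b c d => by
    -- Contract the trilinear form with the fixed vector `b` in its first argument.
    have h3 := (((hf.fderiv_infty hV).fderiv_infty hV).fderiv_infty hV)
    have h3x := h3.differentiableAt_infty hV hx
    have hb := fderiv_bilinear_symm (B := fun y => fderiv ℝ (fderiv ℝ (fderiv ℝ f)) y b) hV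
      (h3.clm_apply contDiffOn_const) (fun y hy c d => thirdFDeriv_comm_right hf hV hy b c d) hx
      a c d
    have hder : fderiv ℝ (fun y => fderiv ℝ (fderiv ℝ (fderiv ℝ f)) y b) x a
        = fderiv ℝ (fderiv ℝ (fderiv ℝ (fderiv ℝ f))) x a b := by
      rw [(h3x.hasFDerivAt.clm_apply (hasFDerivAt_const b x)).fderiv]
      simp
    rwa [hder] at hb
  rw [hmid, hleft a b, hright b a, hmid]

/-- If `D²ψ(ρ, ρ)` vanishes identically, and `D²ψ` vanishes at `x`, then the fourth derivative of
`ψ` at `x` is expressed by the third one. -/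
theorem fourthFDeriv_of_isotropic (hf : ContDiffOn ℝ ∞ f V) (hV : IsOpen V)
    (hρ : ContDiffOn ℝ 2 ρ V) (h : ∀ y ∈ V, fderiv ℝ (fderiv ℝ f) y (ρ y) (ρ y) = 0)
    (hx : x ∈ V) (h0 : fderiv ℝ (fderiv ℝ f) x = 0) (b : E) :
    fderiv ℝ (fderiv ℝ (fderiv ℝ (fderiv ℝ f))) x b b (ρ x) (ρ x)
      = -(4 : ℝ) • fderiv ℝ (fderiv ℝ (fderiv ℝ f)) x b (fderiv ℝ ρ x b) (ρ x) := by
  have h2 := (hf.fderiv_infty hV).fderiv_infty hV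
  have h3 := h2.fderiv_infty hV
  have hρd : ∀ y ∈ V, DifferentiableAt ℝ ρ y := fun y hy =>
    (hρ.differentiableOn (by simp)).differentiableAt (hV.mem_nhds hy)
  have hDρ : DifferentiableAt ℝ (fun y => fderiv ℝ ρ y b) x := by
    have h1 : ContDiffAt ℝ 1 (fderiv ℝ ρ) x :=
      (hρ.contDiffAt (hV.mem_nhds hx)).fderiv_right (by norm_num)
    exact (h1.differentiableAt (by simp)).clm_apply (differentiableAt_const b)
  -- The first derivative of the identity in the direction `b`, at all points.
  have hfirst : ∀ y ∈ V, fderiv ℝ (fderiv ℝ (fderiv ℝ f)) y b (ρ y) (ρ y)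
      + (2 : ℝ) • fderiv ℝ (fderiv ℝ f) y (fderiv ℝ ρ y b) (ρ y) = 0 := by
    intro y hy
    have := leibniz_of_bilinear_eq_zero (h2.differentiableAt_infty hV hy) (hρd y hy) (hρd y hy)
      (by filter_upwards [hV.mem_nhds hy] with z hz using h z hz) b
    rw [fderiv_fderiv_comm hf hV hy (ρ y)] at this
    rw [two_smul, ← this]; abel
  have h3x := h3.differentiableAt_infty hV hx
  obtain ⟨L, hL, hLb⟩ := hasFDerivAt_bilinear
    (B := fun y => fderiv ℝ (fderiv ℝ (fderiv ℝ f)) y b)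
    (h3x.clm_apply (differentiableAt_const b)) (hρd x hx) (hρd x hx) b
  obtain ⟨M, hM, hMb⟩ := hasFDerivAt_bilinear (h2.differentiableAt_infty hV hx) hDρ (hρd x hx) b
  have hder : fderiv ℝ (fun y => fderiv ℝ (fderiv ℝ (fderiv ℝ f)) y b) x b
      = fderiv ℝ (fderiv ℝ (fderiv ℝ (fderiv ℝ f))) x b b := by
    rw [(h3x.hasFDerivAt.clm_apply (hasFDerivAt_const b x)).fderiv]
    simp
  have hzero : (L + (2 : ℝ) • M) b = 0 := by
    rw [(hL.add (hM.const_smul (2 : ℝ))).unique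
      ((hasFDerivAt_const (0 : F) x).congr_of_eventuallyEq (by
        filter_upwards [hV.mem_nhds hx] with y hy using hfirst y hy))]
    rfl
  rw [add_apply, smul_apply, hLb, hMb, hder, h0,
    thirdFDeriv_comm_right hf hV hx b (ρ x)] at hzero
  simp only [zero_apply, add_zero] at hzero
  rw [eq_comm, ← sub_eq_zero, ← neg_eq_zero, ← hzero]
  module

end HigherDerivatives

/-! ### Frame calculus of a T-system -/

section FrameCalculus

/-- A frame of eigenvectors `r i` of the Jacobi matrix of the smooth map `f` with distinct
characteristic velocities, such that the second derivative of `f` vanishes on each pair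
`(r i, r i)`. This is the infinitesimal form of the T-system property: the component of
`D²f(r i, r i)` along `r i` is the derivative of `lam i` along `r i`, and its other components
measure the curvature of the integral curves of `r i`. -/
structure IsIsotropicEigenframe {n : ℕ} (f : (Fin n → ℝ) → (Fin n → ℝ))
    (lam : Fin n → (Fin n → ℝ) → ℝ)
    (V : Set (Fin n → ℝ)) (r : Fin n → (Fin n → ℝ) → (Fin n → ℝ))
    (l : Fin n → (Fin n → ℝ) → ((Fin n → ℝ) →L[ℝ] ℝ)) : Prop
    extends IsEigenframe f lam V r l where
  smooth : ContDiffOn ℝ ∞ f V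
  injective : ∀ x ∈ V, Function.Injective fun i => lam i x
  isotropic : ∀ x ∈ V, ∀ i, fderiv ℝ (fderiv ℝ f) x (r i x) (r i x) = 0

/-- The `k`-th component of `D²f(r i, r j)` in the frame `r`. -/
def hessianCoeff {n : ℕ} (f : (Fin n → ℝ) → (Fin n → ℝ))
    (r : Fin n → (Fin n → ℝ) → (Fin n → ℝ))
    (l : Fin n → (Fin n → ℝ) → ((Fin n → ℝ) →L[ℝ] ℝ)) (k i j : Fin n) (x : Fin n → ℝ) : ℝ :=
  l k x (fderiv ℝ (fderiv ℝ f) x (r i x) (r j x))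

/-- The logarithmic derivative of `lam j - lam i` along `r k`, for `k ≠ i, j`; the derivative of
`lam i` along `r k` is written as the component of `D²f(r i, r k)` along `r i`. -/
def logGapDeriv {n : ℕ} (f : (Fin n → ℝ) → (Fin n → ℝ))
    (lam : Fin n → (Fin n → ℝ) → ℝ) (r : Fin n → (Fin n → ℝ) → (Fin n → ℝ))
    (l : Fin n → (Fin n → ℝ) → ((Fin n → ℝ) →L[ℝ] ℝ)) (i j k : Fin n) (x : Fin n → ℝ) : ℝ :=
  (hessianCoeff f r l j j k x - hessianCoeff f r l i i k x) / (lam j x - lam i x)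

section General

variable {n : ℕ} {f : (Fin n → ℝ) → (Fin n → ℝ)} {U V : Set (Fin n → ℝ)}
  {lam : Fin n → (Fin n → ℝ) → ℝ} {r : Fin n → (Fin n → ℝ) → (Fin n → ℝ)}
  {l : Fin n → (Fin n → ℝ) → ((Fin n → ℝ) →L[ℝ] ℝ)} {x : Fin n → ℝ}

theorem IsEigenframe.sum_smul (hV : IsEigenframe f lam V r l) (hx : x ∈ V) (v : Fin n → ℝ) :
    ∑ i, l i x v • r i x = v := by
  have hli : LinearIndependent ℝ fun i => r i x := by
    rw [Fintype.linearIndependent_iff]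
    intro g hg i
    simpa [hV.dual x hx] using congrArg (l i x) hg
  let b := basisOfLinearIndependentOfCardEqFinrank' (fun i => r i x) hli (by simp)
  have hb : ∀ i, b i = r i x := fun i => by simp [b]
  have : ∑ i, ((l i x : (Fin n → ℝ) →ₗ[ℝ] ℝ)).smulRight (r i x) = LinearMap.id :=
    b.ext fun i => by simp [LinearMap.sum_apply, hb, hV.dual x hx]
  simpa [LinearMap.sum_apply] using LinearMap.congr_fun this v

theorem IsEigenframe.l_apply_fderiv (hV : IsEigenframe f lam V r l) (hx : x ∈ V) (k : Fin n)
    (v : Fin n → ℝ) : l k x (fderiv ℝ f x v) = lam k x * l k x v := by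
  conv_lhs => rw [← hV.sum_smul hx v]
  simp only [map_sum, map_smul, hV.eigen x hx, hV.dual x hx, smul_eq_mul]
  simp [mul_comm]

theorem IsIsotropicEigenframe.hessian_comm (hV : IsIsotropicEigenframe f lam V r l) (hx : x ∈ V)
    (a b : Fin n → ℝ) :
    fderiv ℝ (fderiv ℝ f) x a b = fderiv ℝ (fderiv ℝ f) x b a :=
  fderiv_fderiv_comm hV.smooth hV.isOpen hx a b

theorem IsIsotropicEigenframe.hessianCoeff_comm (hV : IsIsotropicEigenframe f lam V r l)
    (hx : x ∈ V) (k i j : Fin n) : hessianCoeff f r l k i j x = hessianCoeff f r l k j i x := by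
  rw [hessianCoeff, hV.hessian_comm hx, hessianCoeff]

/-- The eigenvector equation, differentiated in the direction `a` and projected to `r k`. -/
theorem IsIsotropicEigenframe.l_apply_hessian (hV : IsIsotropicEigenframe f lam V r l)
    (hx : x ∈ V) {k i : Fin n} (hki : k ≠ i) (a : Fin n → ℝ) :
    l k x (fderiv ℝ (fderiv ℝ f) x a (r i x))
      = (lam i x - lam k x) * l k x (fderiv ℝ (r i) x a) := by
  have hf1 : HasFDerivAt (fderiv ℝ f) (fderiv ℝ (fderiv ℝ f) x) x :=
    ((hV.smooth.fderiv_infty hV.isOpen).differentiableAt_infty hV.isOpen hx).hasFDerivAt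
  have hr := (hV.differentiableAt_r hx i).hasFDerivAt
  have hlam : HasFDerivAt (lam i) (fderiv ℝ (lam i) x) x :=
    (((hV.contDiffOn_lam i).contDiffAt (hV.isOpen.mem_nhds hx)).differentiableAt
      (by simp)).hasFDerivAt
  have h1 : HasFDerivAt (fun y => fderiv ℝ f y (r i y)) _ x := hf1.clm_apply hr
  have h2 : HasFDerivAt (fun y => lam i y • r i y) _ x := hlam.fun_smul hr
  have h3 := h1.unique (h2.congr_of_eventuallyEq (by
    filter_upwards [hV.isOpen.mem_nhds hx] with y hy using hV.eigen y hy i))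
  have h4 := congrArg (fun L => l k x (L a)) h3
  simp [hV.l_apply_fderiv hx, hV.dual x hx, hki] at h4
  linarith

theorem IsIsotropicEigenframe.hessianCoeff_eq (hV : IsIsotropicEigenframe f lam V r l)
    (hx : x ∈ V) {k i : Fin n} (hki : k ≠ i) (j : Fin n) :
    hessianCoeff f r l k j i x = (lam i x - lam k x) * l k x (fderiv ℝ (r i) x (r j x)) :=
  hV.l_apply_hessian hx hki _

theorem IsIsotropicEigenframe.fderiv_l_apply (hV : IsIsotropicEigenframe f lam V r l)
    (hx : x ∈ V) (k m : Fin n) (a : Fin n → ℝ) :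
    fderiv ℝ (l k) x a (r m x) = - l k x (fderiv ℝ (r m) x a) := by
  have h1 : HasFDerivAt (fun y => l k y (r m y)) _ x :=
    ((hV.contDiffAt_l hx k).differentiableAt (by simp)).hasFDerivAt.clm_apply
      (hV.differentiableAt_r hx m).hasFDerivAt
  have h2 := h1.unique ((hasFDerivAt_const (if k = m then (1 : ℝ) else 0) x).congr_of_eventuallyEq
    (by filter_upwards [hV.isOpen.mem_nhds hx] with y hy using hV.dual y hy k m))
  have h3 := congrArg (fun L : (Fin n → ℝ) →L[ℝ] ℝ => L a) h2
  simp at h3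
  linarith

/-- A function whose second derivative vanishes on each pair `(r i, r i)`: the third derivative
`D³ψ(a, r i, r i)` is determined by the second one. -/
theorem IsIsotropicEigenframe.thirdFDeriv_apply_same {F : Type*} [NormedAddCommGroup F]
    [NormedSpace ℝ F] {ψ : (Fin n → ℝ) → F} (hV : IsIsotropicEigenframe f lam V r l)
    (hψ : ContDiffOn ℝ ∞ ψ V) (h : ∀ y ∈ V, ∀ i, fderiv ℝ (fderiv ℝ ψ) y (r i y) (r i y) = 0)
    (hx : x ∈ V) (i : Fin n) (a : Fin n → ℝ) :
    fderiv ℝ (fderiv ℝ (fderiv ℝ ψ)) x a (r i x) (r i x)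
      = -(2 : ℝ) • fderiv ℝ (fderiv ℝ ψ) x (fderiv ℝ (r i) x a) (r i x) := by
  have h1 := leibniz_of_bilinear_eq_zero
    (((hψ.fderiv_infty hV.isOpen).fderiv_infty hV.isOpen).differentiableAt_infty hV.isOpen hx)
    (hV.differentiableAt_r hx i) (hV.differentiableAt_r hx i)
    (by filter_upwards [hV.isOpen.mem_nhds hx] with z hz using h z hz i) a
  rw [fderiv_fderiv_comm hψ hV.isOpen hx (r i x)] at h1
  rw [← sub_eq_zero, ← h1]
  module

end General

section Three

theorem Fin.sum_eq_of_ne {M : Type*} [AddCommMonoid M] {i j k : Fin 3} (hij : i ≠ j)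
    (hjk : j ≠ k) (hki : k ≠ i) (g : Fin 3 → M) : ∑ m, g m = g i + g j + g k := by
  have : (Finset.univ : Finset (Fin 3)) = {i, j, k} := by
    revert i j k; decide
  rw [this, Finset.sum_insert (by simp [hij, hki.symm]), Finset.sum_insert (by simpa using hjk),
    Finset.sum_singleton, add_assoc]

variable {f : (Fin 3 → ℝ) → (Fin 3 → ℝ)} {U V : Set (Fin 3 → ℝ)}
  {lam : Fin 3 → (Fin 3 → ℝ) → ℝ} {r : Fin 3 → (Fin 3 → ℝ) → (Fin 3 → ℝ)}
  {l : Fin 3 → (Fin 3 → ℝ) → ((Fin 3 → ℝ) →L[ℝ] ℝ)} {x : Fin 3 → ℝ} {i j k : Fin 3}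

theorem IsEigenframe.expand (hV : IsEigenframe f lam V r l) (hx : x ∈ V) (hij : i ≠ j)
    (hjk : j ≠ k) (hki : k ≠ i) (v : Fin 3 → ℝ) :
    v = l i x v • r i x + l j x v • r j x + l k x v • r k x := by
  rw [← Fin.sum_eq_of_ne hij hjk hki (fun m => l m x v • r m x), hV.sum_smul hx]

/-- Where the planes spanned by `r i` and `r j` are integrable (equivalently,
`hessianCoeff f r l k i j = 0`), the component of `D³f(r k, r i, r j)` along `r k` is found by
differentiating `hessianCoeff f r l k i j = 0` along `r k`. -/
theorem IsIsotropicEigenframe.l_apply_thirdFDeriv (hV : IsIsotropicEigenframe f lam V r l)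
    (hx : x ∈ V) (hij : i ≠ j) (hjk : j ≠ k) (hki : k ≠ i)
    (h : ∀ᶠ y in 𝓝 x, hessianCoeff f r l k i j y = 0) :
    l k x (fderiv ℝ (fderiv ℝ (fderiv ℝ f)) x (r k x) (r i x) (r j x))
      = logGapDeriv f lam r l j k i x * hessianCoeff f r l k j k x
        + logGapDeriv f lam r l k i j x * hessianCoeff f r l k k i x := by
  have h2 := (((hV.smooth.fderiv_infty hV.isOpen).fderiv_infty hV.isOpen).differentiableAt_infty
    hV.isOpen hx)
  obtain ⟨L, hL, hLa⟩ := hasFDerivAt_bilinear h2 (hV.differentiableAt_r hx i)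
    (hV.differentiableAt_r hx j) (r k x)
  have hd : HasFDerivAt (hessianCoeff f r l k i j) _ x :=
    ((hV.contDiffAt_l hx k).differentiableAt (by simp)).hasFDerivAt.clm_apply hL
  have h3 := congrArg (fun L : (Fin 3 → ℝ) →L[ℝ] ℝ => L (r k x))
    (hd.unique ((hasFDerivAt_const (0 : ℝ) x).congr_of_eventuallyEq h))
  have hk : l k x (fderiv ℝ (fderiv ℝ f) x (r i x) (r j x)) = 0 := h.self_of_nhds
  have e1 : fderiv ℝ (l k) x (r k x) (fderiv ℝ (fderiv ℝ f) x (r i x) (r j x))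
      = - hessianCoeff f r l i i j x * l k x (fderiv ℝ (r i) x (r k x))
        - hessianCoeff f r l j i j x * l k x (fderiv ℝ (r j) x (r k x)) := by
    rw [hV.expand hx hij hjk hki (fderiv ℝ (fderiv ℝ f) x (r i x) (r j x)), hk]
    simp only [map_add, map_smul, hV.fderiv_l_apply hx, smul_eq_mul, hessianCoeff]
    ring
  have e2 : l k x (fderiv ℝ (fderiv ℝ f) x (fderiv ℝ (r i) x (r k x)) (r j x))
      = l k x (fderiv ℝ (r i) x (r k x)) * hessianCoeff f r l k k j x := by
    conv_lhs => rw [hV.expand hx hij hjk hki (fderiv ℝ (r i) x (r k x))]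
    simp only [map_add, map_smul, add_apply, smul_apply, hV.isotropic x hx, hk,
      smul_eq_mul, hessianCoeff]
    simp
  have e3 : l k x (fderiv ℝ (fderiv ℝ f) x (r i x) (fderiv ℝ (r j) x (r k x)))
      = l k x (fderiv ℝ (r j) x (r k x)) * hessianCoeff f r l k k i x := by
    conv_lhs => rw [hV.expand hx hij hjk hki (fderiv ℝ (r j) x (r k x))]
    simp only [map_add, map_smul, hV.isotropic x hx, hk, smul_eq_mul, hessianCoeff,
      hV.hessian_comm hx (r i x) (r k x)]
    simp
  have h4 : l k x (fderiv ℝ (fderiv ℝ (fderiv ℝ f)) x (r k x) (r i x) (r j x))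
      + l k x (fderiv ℝ (fderiv ℝ f) x (fderiv ℝ (r i) x (r k x)) (r j x))
      + l k x (fderiv ℝ (fderiv ℝ f) x (r i x) (fderiv ℝ (r j) x (r k x)))
      + fderiv ℝ (l k) x (r k x) (fderiv ℝ (fderiv ℝ f) x (r i x) (r j x)) = 0 := by
    simpa [hLa] using h3
  rw [e1, e2, e3] at h4
  have hi := hV.hessianCoeff_eq hx hki k
  have hj := hV.hessianCoeff_eq hx hjk.symm k
  have hne1 : lam k x - lam j x ≠ 0 := sub_ne_zero.2 ((hV.injective x hx).ne hjk.symm)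
  have hne2 : lam i x - lam k x ≠ 0 := sub_ne_zero.2 ((hV.injective x hx).ne hki.symm)
  rw [logGapDeriv, logGapDeriv, hV.hessianCoeff_comm hx k j k, hV.hessianCoeff_comm hx j j i]
  rw [hi, hj] at h4 ⊢
  field_simp
  linear_combination (lam k x - lam j x) * h4

/-- At a point where the planes spanned by `r i` and `r j` are not integrable, the symmetry
`D⁴ψ(r i, r i, r j, r j) = D⁴ψ(r j, r j, r i, r i)` forces `D³ψ = 0` as soon as `D²ψ = 0`. -/
theorem IsIsotropicEigenframe.thirdFDeriv_eq_zero {ψ : (Fin 3 → ℝ) → ℝ}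
    (hV : IsIsotropicEigenframe f lam V r l) (hψ : ContDiffOn ℝ ∞ ψ V)
    (hiso : ∀ y ∈ V, ∀ i, fderiv ℝ (fderiv ℝ ψ) y (r i y) (r i y) = 0)
    (hx : x ∈ V) (h0 : fderiv ℝ (fderiv ℝ ψ) x = 0) (hij : i ≠ j) (hjk : j ≠ k) (hki : k ≠ i)
    (hH : hessianCoeff f r l k i j x ≠ 0) :
    fderiv ℝ (fderiv ℝ (fderiv ℝ ψ)) x (r i x) (r j x) (r k x) = 0 := by
  have hleft := thirdFDeriv_comm_left hψ hV.isOpen hx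
  have hright := thirdFDeriv_comm_right hψ hV.isOpen hx
  have hsame : ∀ i a, fderiv ℝ (fderiv ℝ (fderiv ℝ ψ)) x a (r i x) (r i x) = 0 := fun i a => by
    rw [hV.thirdFDeriv_apply_same hψ hiso hx, h0]
    simp
  have e1 : fderiv ℝ (fderiv ℝ (fderiv ℝ ψ)) x (r j x) (fderiv ℝ (r i) x (r j x)) (r i x)
      = l k x (fderiv ℝ (r i) x (r j x))
        * fderiv ℝ (fderiv ℝ (fderiv ℝ ψ)) x (r i x) (r j x) (r k x) := by
    conv_lhs => rw [hV.expand hx hij hjk hki (fderiv ℝ (r i) x (r j x))]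
    have h1 : fderiv ℝ (fderiv ℝ (fderiv ℝ ψ)) x (r j x) (r j x) (r i x) = 0 := by
      rw [hright, hleft]; exact hsame j _
    have h2 : fderiv ℝ (fderiv ℝ (fderiv ℝ ψ)) x (r j x) (r k x) (r i x)
        = fderiv ℝ (fderiv ℝ (fderiv ℝ ψ)) x (r i x) (r j x) (r k x) := by
      rw [hright, hleft]
    simp only [map_add, map_smul, add_apply, smul_apply, hsame, h1, h2, smul_eq_mul]
    ring
  have e2 : fderiv ℝ (fderiv ℝ (fderiv ℝ ψ)) x (r i x) (fderiv ℝ (r j) x (r i x)) (r j x)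
      = l k x (fderiv ℝ (r j) x (r i x))
        * fderiv ℝ (fderiv ℝ (fderiv ℝ ψ)) x (r i x) (r j x) (r k x) := by
    conv_lhs => rw [hV.expand hx hij hjk hki (fderiv ℝ (r j) x (r i x))]
    have h1 : fderiv ℝ (fderiv ℝ (fderiv ℝ ψ)) x (r i x) (r i x) (r j x) = 0 := by
      rw [hright, hleft]; exact hsame i _
    have h2 : fderiv ℝ (fderiv ℝ (fderiv ℝ ψ)) x (r i x) (r k x) (r j x)
        = fderiv ℝ (fderiv ℝ (fderiv ℝ ψ)) x (r i x) (r j x) (r k x) := by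
      rw [hright]
    simp only [map_add, map_smul, add_apply, smul_apply, hsame, h1, h2, smul_eq_mul]
    ring
  have h4 := fourthFDeriv_swap hψ hV.isOpen hx (r j x) (r i x)
  rw [fourthFDeriv_of_isotropic hψ hV.isOpen (hV.contDiffOn_r i) (fun y hy => hiso y hy i) hx h0,
    fourthFDeriv_of_isotropic hψ hV.isOpen (hV.contDiffOn_r j) (fun y hy => hiso y hy j) hx h0,
    e1, e2] at h4
  have hi := hV.hessianCoeff_eq hx hki j
  have hj := hV.hessianCoeff_eq hx hjk.symm i
  rw [hV.hessianCoeff_comm hx k j i] at hi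
  have hne : lam i x - lam j x ≠ 0 := sub_ne_zero.2 ((hV.injective x hx).ne hij)
  by_contra hT
  simp only [smul_eq_mul] at h4
  have h5 : l k x (fderiv ℝ (r i) x (r j x)) = l k x (fderiv ℝ (r j) x (r i x)) := by
    refine mul_right_cancel₀ hT ?_
    linarith
  rw [h5] at hi
  have h6 : (lam i x - lam j x) * l k x (fderiv ℝ (r j) x (r i x)) = 0 := by linarith
  rw [(mul_eq_zero.1 h6).resolve_left hne, mul_zero] at hi
  exact hH hi

end Three

end FrameCalculus

/-! ### Linear functions of the Plücker coordinates on the congruence -/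

section CongruenceFunction

variable {n : ℕ} {f : (Fin n → ℝ) → (Fin n → ℝ)} {U V : Set (Fin n → ℝ)}
  {lam : Fin n → (Fin n → ℝ) → ℝ} {r : Fin n → (Fin n → ℝ) → (Fin n → ℝ)}
  {l : Fin n → (Fin n → ℝ) → ((Fin n → ℝ) →L[ℝ] ℝ)} {x : Fin n → ℝ}

/-- The restriction to the congruence `p = f(u)` of a linear function of the Plücker coordinates
`1, u, p, u ∧ p`. The coefficients of `u ∧ p` are given by a bilinear form `δ`, which is always
taken to be alternating. -/
def congruenceFunction (f : (Fin n → ℝ) → (Fin n → ℝ)) (α : ℝ) (β γ : (Fin n → ℝ) →L[ℝ] ℝ)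
    (δ : (Fin n → ℝ) →L[ℝ] (Fin n → ℝ) →L[ℝ] ℝ) (u : Fin n → ℝ) : ℝ :=
  α + β u + γ (f u) + δ u (f u)

theorem fderiv_clm_apply_const {E F G : Type*} [NormedAddCommGroup E] [NormedSpace ℝ E]
    [NormedAddCommGroup F] [NormedSpace ℝ F] [NormedAddCommGroup G] [NormedSpace ℝ G]
    {B : E → F →L[ℝ] G} {x : E} (hB : DifferentiableAt ℝ B x) (b : F) (a : E) :
    fderiv ℝ (fun y => B y b) x a = fderiv ℝ B x a b := by
  rw [(hB.hasFDerivAt.clm_apply (hasFDerivAt_const b x)).fderiv]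
  simp

variable (α : ℝ) (β γ : (Fin n → ℝ) →L[ℝ] ℝ) (δ : (Fin n → ℝ) →L[ℝ] (Fin n → ℝ) →L[ℝ] ℝ)

theorem contDiffOn_congruenceFunction (hf : ContDiffOn ℝ ∞ f V) :
    ContDiffOn ℝ ∞ (congruenceFunction f α β γ δ) V := by
  have h1 : ContDiffOn ℝ ∞ (fun u => δ u) V := δ.contDiff.contDiffOn
  have h2 : ContDiffOn ℝ ∞ (fun u => β u) V := β.contDiff.contDiffOn
  exact ((contDiffOn_const.add h2).add (γ.contDiff.comp_contDiffOn hf)).add (h1.clm_apply hf)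

theorem fderiv_congruenceFunction (hf : ContDiffOn ℝ ∞ f V) (hV : IsOpen V) (hx : x ∈ V)
    (a : Fin n → ℝ) :
    fderiv ℝ (congruenceFunction f α β γ δ) x a
      = β a + γ (fderiv ℝ f x a) + δ a (f x) + δ x (fderiv ℝ f x a) := by
  have h0 := (hf.differentiableAt_infty hV hx).hasFDerivAt
  have h1 : HasFDerivAt (congruenceFunction f α β γ δ) _ x :=
    ((β.hasFDerivAt.const_add α).add (γ.hasFDerivAt.comp x h0)).add
      (δ.hasFDerivAt.clm_apply h0)
  rw [h1.fderiv]
  simp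
  ring

theorem fderiv_fderiv_congruenceFunction (hf : ContDiffOn ℝ ∞ f V) (hV : IsOpen V) (hx : x ∈ V)
    (a b : Fin n → ℝ) :
    fderiv ℝ (fderiv ℝ (congruenceFunction f α β γ δ)) x a b
      = γ (fderiv ℝ (fderiv ℝ f) x a b) + δ b (fderiv ℝ f x a) + δ a (fderiv ℝ f x b)
        + δ x (fderiv ℝ (fderiv ℝ f) x a b) := by
  have hψ := contDiffOn_congruenceFunction α β γ δ hf
  have h1 := (hf.fderiv_infty hV).differentiableAt_infty hV hx
  have h0 := (hf.differentiableAt_infty hV hx).hasFDerivAt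
  have h1b : HasFDerivAt (fun y => fderiv ℝ f y b) _ x :=
    h1.hasFDerivAt.clm_apply (hasFDerivAt_const b x)
  have h2 : HasFDerivAt
      (fun y => β b + γ (fderiv ℝ f y b) + δ b (f y) + δ y (fderiv ℝ f y b)) _ x :=
    (((γ.hasFDerivAt.comp x h1b).const_add (β b)).add ((δ b).hasFDerivAt.comp x h0)).add
      (δ.hasFDerivAt.clm_apply h1b)
  rw [← fderiv_clm_apply_const ((hψ.fderiv_infty hV).differentiableAt_infty hV hx),
    Filter.EventuallyEq.fderiv_eq (f₁ := fun y => fderiv ℝ (congruenceFunction f α β γ δ) y b)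
      (f := fun y => β b + γ (fderiv ℝ f y b) + δ b (f y) + δ y (fderiv ℝ f y b))
      (by filter_upwards [hV.mem_nhds hx] with y hy
          using fderiv_congruenceFunction α β γ δ hf hV hy b), h2.fderiv]
  simp
  ring

theorem thirdFDeriv_congruenceFunction (hf : ContDiffOn ℝ ∞ f V) (hV : IsOpen V) (hx : x ∈ V)
    (a b c : Fin n → ℝ) :
    fderiv ℝ (fderiv ℝ (fderiv ℝ (congruenceFunction f α β γ δ))) x a b c
      = γ (fderiv ℝ (fderiv ℝ (fderiv ℝ f)) x a b c) + δ c (fderiv ℝ (fderiv ℝ f) x a b)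
        + δ b (fderiv ℝ (fderiv ℝ f) x a c) + δ a (fderiv ℝ (fderiv ℝ f) x b c)
        + δ x (fderiv ℝ (fderiv ℝ (fderiv ℝ f)) x a b c) := by
  have hψ := contDiffOn_congruenceFunction α β γ δ hf
  have hψ2 := ((hψ.fderiv_infty hV).fderiv_infty hV).differentiableAt_infty hV hx
  have h1 := ((hf.fderiv_infty hV).differentiableAt_infty hV hx).hasFDerivAt
  have h2 := (((hf.fderiv_infty hV).fderiv_infty hV).differentiableAt_infty hV hx).hasFDerivAt
  have h1b : HasFDerivAt (fun y => fderiv ℝ f y b) _ x := h1.clm_apply (hasFDerivAt_const b x)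
  have h1c : HasFDerivAt (fun y => fderiv ℝ f y c) _ x := h1.clm_apply (hasFDerivAt_const c x)
  have h2bc : HasFDerivAt (fun y => fderiv ℝ (fderiv ℝ f) y b c) _ x :=
    (h2.clm_apply (hasFDerivAt_const b x)).clm_apply (hasFDerivAt_const c x)
  have h3 : HasFDerivAt
      (fun y => γ (fderiv ℝ (fderiv ℝ f) y b c) + δ c (fderiv ℝ f y b) + δ b (fderiv ℝ f y c)
        + δ y (fderiv ℝ (fderiv ℝ f) y b c)) _ x :=
    (((γ.hasFDerivAt.comp x h2bc).add ((δ c).hasFDerivAt.comp x h1b)).add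
      ((δ b).hasFDerivAt.comp x h1c)).add (δ.hasFDerivAt.clm_apply h2bc)
  rw [← fderiv_clm_apply_const hψ2, ← fderiv_clm_apply_const (hψ2.clm_apply
      (differentiableAt_const b)),
    Filter.EventuallyEq.fderiv_eq
      (f₁ := fun y => fderiv ℝ (fderiv ℝ (congruenceFunction f α β γ δ)) y b c)
      (f := fun y => γ (fderiv ℝ (fderiv ℝ f) y b c) + δ c (fderiv ℝ f y b)
        + δ b (fderiv ℝ f y c) + δ y (fderiv ℝ (fderiv ℝ f) y b c))
      (by filter_upwards [hV.mem_nhds hx] with y hy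
          using fderiv_fderiv_congruenceFunction α β γ δ hf hV hy b c), h3.fderiv]
  simp
  ring

variable {α β γ δ}

theorem IsIsotropicEigenframe.hessian_congruenceFunction
    (hV : IsIsotropicEigenframe f lam V r l) (hδ : ∀ a b, δ a b = - δ b a) (hx : x ∈ V)
    (i j : Fin n) :
    fderiv ℝ (fderiv ℝ (congruenceFunction f α β γ δ)) x (r i x) (r j x)
      = (γ + δ x) (fderiv ℝ (fderiv ℝ f) x (r i x) (r j x))
        + (lam j x - lam i x) * δ (r i x) (r j x) := by
  rw [fderiv_fderiv_congruenceFunction α β γ δ hV.smooth hV.isOpen hx, hV.eigen x hx,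
    hV.eigen x hx, map_smul, map_smul, hδ (r j x), add_apply]
  simp only [smul_eq_mul]
  ring

theorem IsIsotropicEigenframe.hessian_congruenceFunction_self
    (hV : IsIsotropicEigenframe f lam V r l) (hδ : ∀ a b, δ a b = - δ b a) :
    ∀ y ∈ V, ∀ i,
      fderiv ℝ (fderiv ℝ (congruenceFunction f α β γ δ)) y (r i y) (r i y) = 0 := by
  intro y hy i
  rw [hV.hessian_congruenceFunction hδ hy, hV.isotropic y hy]
  simp

/-- Bilinear forms are determined by their values on the frame. -/
theorem IsEigenframe.bilinear_ext (hV : IsEigenframe f lam V r l) (hx : x ∈ V)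
    {F : Type*} [NormedAddCommGroup F] [NormedSpace ℝ F]
    {B : (Fin n → ℝ) →L[ℝ] (Fin n → ℝ) →L[ℝ] F} (h : ∀ i j, B (r i x) (r j x) = 0) : B = 0 := by
  ext1 a
  ext1 b
  rw [← hV.sum_smul hx a, ← hV.sum_smul hx b]
  simp [sum_apply, h]

/-- The second derivative of a linear function of the Plücker coordinates at a point of the
congruence can be annulled by a choice of `δ`, when the covector `g = γ + δ x` is given: the values
of `δ` on the frame are prescribed, with the nonzero factors `lam j x - lam i x`. -/
theorem IsIsotropicEigenframe.exists_hessian_eq_zero (hV : IsIsotropicEigenframe f lam V r l)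
    (hx : x ∈ V) (g : (Fin n → ℝ) →L[ℝ] ℝ) :
    ∃ δ : (Fin n → ℝ) →L[ℝ] (Fin n → ℝ) →L[ℝ] ℝ, (∀ a b, δ a b = - δ b a) ∧
      ∀ α β, fderiv ℝ (fderiv ℝ (congruenceFunction f α β (g - δ x) δ)) x = 0 := by
  -- On the diagonal the numerator vanishes along with the denominator.
  let S : Fin n → Fin n → ℝ := fun i j =>
    - g (fderiv ℝ (fderiv ℝ f) x (r i x) (r j x)) / (lam j x - lam i x)
  have hS : ∀ i j, S i j = - S j i := by
    intro i j
    simp only [S]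
    rw [hV.hessian_comm hx (r j x), ← neg_sub (lam j x) (lam i x), div_neg, neg_neg]
  let δ : (Fin n → ℝ) →L[ℝ] (Fin n → ℝ) →L[ℝ] ℝ :=
    ∑ i, ∑ j, S i j • (l i x).smulRight (l j x)
  have hδ : ∀ a b, δ a b = ∑ i, ∑ j, S i j * (l i x a * l j x b) := by
    intro a b
    simp [δ, sum_apply]
  have hδr : ∀ i j, δ (r i x) (r j x) = S i j := by
    intro i j
    simp [hδ, hV.dual x hx]
  have hδa : ∀ a b, δ a b = - δ b a := by
    intro a b
    rw [hδ, hδ, Finset.sum_comm, ← Finset.sum_neg_distrib]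
    refine Finset.sum_congr rfl fun i _ => ?_
    rw [← Finset.sum_neg_distrib]
    refine Finset.sum_congr rfl fun j _ => ?_
    rw [hS]
    ring
  refine ⟨δ, hδa, fun α β => hV.bilinear_ext hx fun i j => ?_⟩
  rw [hV.hessian_congruenceFunction hδa hx, hδr, sub_add_cancel]
  by_cases hij : i = j
  · subst hij
    rw [hV.isotropic x hx]
    simp
  · have : lam j x - lam i x ≠ 0 := sub_ne_zero.2 ((hV.injective x hx).ne (Ne.symm hij))
    simp only [S]
    field_simp
    ring

end CongruenceFunction

/-! ### The mixed third derivative of a T-system -/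

section MixedThirdDerivative

variable {f : (Fin 3 → ℝ) → (Fin 3 → ℝ)} {U V : Set (Fin 3 → ℝ)}
  {lam : Fin 3 → (Fin 3 → ℝ) → ℝ} {r : Fin 3 → (Fin 3 → ℝ) → (Fin 3 → ℝ)}
  {l : Fin 3 → (Fin 3 → ℝ) → ((Fin 3 → ℝ) →L[ℝ] ℝ)} {x : Fin 3 → ℝ}
  {α : ℝ} {β γ : (Fin 3 → ℝ) →L[ℝ] ℝ} {δ : (Fin 3 → ℝ) →L[ℝ] (Fin 3 → ℝ) →L[ℝ] ℝ}

/-- The difference between the mixed third derivative `D³f(r 0, r 1, r 2)` and the combination of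
the mixed second derivatives `D²f(r i, r j)` with the coefficients `logGapDeriv`. -/
def mixedResidual (f : (Fin 3 → ℝ) → (Fin 3 → ℝ))
    (lam : Fin 3 → (Fin 3 → ℝ) → ℝ) (r : Fin 3 → (Fin 3 → ℝ) → (Fin 3 → ℝ))
    (l : Fin 3 → (Fin 3 → ℝ) → ((Fin 3 → ℝ) →L[ℝ] ℝ)) (x : Fin 3 → ℝ) : Fin 3 → ℝ :=
  fderiv ℝ (fderiv ℝ (fderiv ℝ f)) x (r 0 x) (r 1 x) (r 2 x)
    - logGapDeriv f lam r l 0 1 2 x • fderiv ℝ (fderiv ℝ f) x (r 0 x) (r 1 x)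
    - logGapDeriv f lam r l 1 2 0 x • fderiv ℝ (fderiv ℝ f) x (r 1 x) (r 2 x)
    - logGapDeriv f lam r l 2 0 1 x • fderiv ℝ (fderiv ℝ f) x (r 2 x) (r 0 x)

/-- The coefficients `logGapDeriv` are those for which the terms with `u ∧ f` agree. -/
theorem IsIsotropicEigenframe.thirdFDeriv_congruenceFunction_eq
    (hV : IsIsotropicEigenframe f lam V r l) (hδ : ∀ a b, δ a b = - δ b a) (hx : x ∈ V) :
    fderiv ℝ (fderiv ℝ (fderiv ℝ (congruenceFunction f α β γ δ))) x (r 0 x) (r 1 x) (r 2 x)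
      = logGapDeriv f lam r l 0 1 2 x
          * fderiv ℝ (fderiv ℝ (congruenceFunction f α β γ δ)) x (r 0 x) (r 1 x)
        + logGapDeriv f lam r l 1 2 0 x
          * fderiv ℝ (fderiv ℝ (congruenceFunction f α β γ δ)) x (r 1 x) (r 2 x)
        + logGapDeriv f lam r l 2 0 1 x
          * fderiv ℝ (fderiv ℝ (congruenceFunction f α β γ δ)) x (r 2 x) (r 0 x)
        + (γ + δ x) (mixedResidual f lam r l x) := by
  have hδ0 : ∀ a, δ a a = 0 := fun a => by linarith [hδ a a]
  have key : ∀ m i j : Fin 3, δ (r m x) (fderiv ℝ (fderiv ℝ f) x (r i x) (r j x))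
      = hessianCoeff f r l 0 i j x * δ (r m x) (r 0 x)
        + hessianCoeff f r l 1 i j x * δ (r m x) (r 1 x)
        + hessianCoeff f r l 2 i j x * δ (r m x) (r 2 x) := by
    intro m i j
    conv_lhs => rw [hV.expand hx (i := 0) (j := 1) (k := 2) (by decide) (by decide) (by decide)
      (fderiv ℝ (fderiv ℝ f) x (r i x) (r j x))]
    simp only [map_add, map_smul, smul_eq_mul, hessianCoeff]
  have h01 : lam 1 x - lam 0 x ≠ 0 := sub_ne_zero.2 ((hV.injective x hx).ne (by decide))
  have h12 : lam 2 x - lam 1 x ≠ 0 := sub_ne_zero.2 ((hV.injective x hx).ne (by decide))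
  have h20 : lam 0 x - lam 2 x ≠ 0 := sub_ne_zero.2 ((hV.injective x hx).ne (by decide))
  have g01 : logGapDeriv f lam r l 0 1 2 x * (lam 1 x - lam 0 x)
      = hessianCoeff f r l 1 1 2 x - hessianCoeff f r l 0 0 2 x := div_mul_cancel₀ _ h01
  have g12 : logGapDeriv f lam r l 1 2 0 x * (lam 2 x - lam 1 x)
      = hessianCoeff f r l 2 2 0 x - hessianCoeff f r l 1 1 0 x := div_mul_cancel₀ _ h12
  have g20 : logGapDeriv f lam r l 2 0 1 x * (lam 0 x - lam 2 x)
      = hessianCoeff f r l 0 0 1 x - hessianCoeff f r l 2 2 1 x := div_mul_cancel₀ _ h20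
  rw [hV.hessian_congruenceFunction hδ hx, hV.hessian_congruenceFunction hδ hx,
    hV.hessian_congruenceFunction hδ hx,
    thirdFDeriv_congruenceFunction α β γ δ hV.smooth hV.isOpen hx, key, key, key, mixedResidual]
  simp only [map_sub, map_smul, smul_eq_mul, add_apply, hδ0, hδ (r 1 x) (r 0 x),
    hδ (r 2 x) (r 0 x), hδ (r 2 x) (r 1 x)]
  rw [hV.hessianCoeff_comm hx 2 0 2, hV.hessianCoeff_comm hx 1 0 1,
    hV.hessianCoeff_comm hx 2 1 2] at *
  linear_combination (-δ (r 0 x) (r 1 x)) * g01 + (-δ (r 1 x) (r 2 x)) * g12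
    + (δ (r 0 x) (r 2 x)) * g20

theorem IsIsotropicEigenframe.mixedResidual_eq_zero_of_ne
    (hV : IsIsotropicEigenframe f lam V r l) (hx : x ∈ V)
    (h : hessianCoeff f r l 2 0 1 x ≠ 0 ∨ hessianCoeff f r l 0 1 2 x ≠ 0 ∨
      hessianCoeff f r l 1 2 0 x ≠ 0) : mixedResidual f lam r l x = 0 := by
  have hg : ∀ g : (Fin 3 → ℝ) →L[ℝ] ℝ, g (mixedResidual f lam r l x) = 0 := by
    intro g
    obtain ⟨δ, hδ, h0⟩ := hV.exists_hessian_eq_zero hx g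
    have hψ := contDiffOn_congruenceFunction 0 0 (g - δ x) δ hV.smooth
    have hiso := hV.hessian_congruenceFunction_self (α := 0) (β := 0) (γ := g - δ x) hδ
    have hleft := thirdFDeriv_comm_left hψ hV.isOpen hx
    have hright := thirdFDeriv_comm_right hψ hV.isOpen hx
    have h3 : fderiv ℝ (fderiv ℝ (fderiv ℝ (congruenceFunction f 0 0 (g - δ x) δ))) x
        (r 0 x) (r 1 x) (r 2 x) = 0 := by
      rcases h with h | h | h
      · exact hV.thirdFDeriv_eq_zero hψ hiso hx (h0 0 0) (by decide) (by decide) (by decide) h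
      · rw [hleft, hright]
        exact hV.thirdFDeriv_eq_zero hψ hiso hx (h0 0 0) (by decide) (by decide) (by decide) h
      · rw [hright, hleft]
        exact hV.thirdFDeriv_eq_zero hψ hiso hx (h0 0 0) (by decide) (by decide) (by decide) h
    rw [hV.thirdFDeriv_congruenceFunction_eq hδ hx, h0 0 0] at h3
    simpa using h3
  funext i
  exact hg (ContinuousLinearMap.proj i)

theorem IsIsotropicEigenframe.mixedResidual_eq_zero_of_eventually
    (hV : IsIsotropicEigenframe f lam V r l) (hx : x ∈ V)
    (h2 : ∀ᶠ y in 𝓝 x, hessianCoeff f r l 2 0 1 y = 0)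
    (h0 : ∀ᶠ y in 𝓝 x, hessianCoeff f r l 0 1 2 y = 0)
    (h1 : ∀ᶠ y in 𝓝 x, hessianCoeff f r l 1 2 0 y = 0) : mixedResidual f lam r l x = 0 := by
  have hleft := thirdFDeriv_comm_left hV.smooth hV.isOpen hx
  have hright := thirdFDeriv_comm_right hV.smooth hV.isOpen hx
  have e2 := hV.l_apply_thirdFDeriv hx (i := 0) (j := 1) (k := 2) (by decide) (by decide)
    (by decide) h2
  have e0 := hV.l_apply_thirdFDeriv hx (i := 1) (j := 2) (k := 0) (by decide) (by decide)
    (by decide) h0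
  have e1 := hV.l_apply_thirdFDeriv hx (i := 2) (j := 0) (k := 1) (by decide) (by decide)
    (by decide) h1
  rw [hleft, hright] at e2
  rw [hright, hleft] at e1
  have c2 := h2.self_of_nhds
  have c0 := h0.self_of_nhds
  have c1 := h1.self_of_nhds
  simp only [hessianCoeff] at e0 e1 e2 c0 c1 c2
  rw [← hV.sum_smul hx (mixedResidual f lam r l x)]
  refine Finset.sum_eq_zero fun k _ => ?_
  rw [mixedResidual]
  simp only [map_sub, map_smul, smul_eq_mul]
  fin_cases k
  · simp [e0, c0]
  · simp [e1, c1]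
  · simp [e2, c2]

theorem IsIsotropicEigenframe.continuousOn_hessian (hV : IsIsotropicEigenframe f lam V r l)
    (i j : Fin 3) : ContinuousOn (fun x => fderiv ℝ (fderiv ℝ f) x (r i x) (r j x)) V :=
  ((((hV.smooth.fderiv_infty hV.isOpen).fderiv_infty hV.isOpen).continuousOn.clm_apply
    (hV.contDiffOn_r i).continuousOn).clm_apply (hV.contDiffOn_r j).continuousOn)

theorem IsIsotropicEigenframe.continuousOn_hessianCoeff
    (hV : IsIsotropicEigenframe f lam V r l) (k i j : Fin 3) :
    ContinuousOn (hessianCoeff f r l k i j) V :=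
  (hV.contDiffOn_l k).continuousOn.clm_apply (hV.continuousOn_hessian i j)

theorem IsIsotropicEigenframe.continuousOn_logGapDeriv
    (hV : IsIsotropicEigenframe f lam V r l) {i j : Fin 3} (hij : i ≠ j) (k : Fin 3) :
    ContinuousOn (logGapDeriv f lam r l i j k) V :=
  ((hV.continuousOn_hessianCoeff j j k).sub (hV.continuousOn_hessianCoeff i i k)).div
    ((hV.contDiffOn_lam j).continuousOn.sub (hV.contDiffOn_lam i).continuousOn)
    fun x hx => sub_ne_zero.2 ((hV.injective x hx).ne hij.symm)

theorem IsIsotropicEigenframe.continuousOn_mixedResidual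
    (hV : IsIsotropicEigenframe f lam V r l) : ContinuousOn (mixedResidual f lam r l) V := by
  have h3 := ((hV.smooth.fderiv_infty hV.isOpen).fderiv_infty hV.isOpen).fderiv_infty hV.isOpen
  have hr := fun i => (hV.contDiffOn_r i).continuousOn
  exact (((((h3.continuousOn.clm_apply (hr 0)).clm_apply (hr 1)).clm_apply (hr 2)).sub
    ((hV.continuousOn_logGapDeriv (by decide) 2).smul (hV.continuousOn_hessian 0 1))).sub
    ((hV.continuousOn_logGapDeriv (by decide) 0).smul (hV.continuousOn_hessian 1 2))).sub
    ((hV.continuousOn_logGapDeriv (by decide) 1).smul (hV.continuousOn_hessian 2 0))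

/-- The points where some plane field of the frame is not integrable, and the interior of the set
where all three are integrable, together are dense. -/
theorem IsIsotropicEigenframe.mixedResidual_eq_zero
    (hV : IsIsotropicEigenframe f lam V r l) (hx : x ∈ V) : mixedResidual f lam r l x = 0 := by
  by_contra hne
  have hev : ∀ᶠ y in 𝓝 x, mixedResidual f lam r l y ≠ 0 :=
    (hV.continuousOn_mixedResidual.continuousAt (hV.isOpen.mem_nhds hx)).eventually_ne hne
  have hzero : ∀ᶠ y in 𝓝 x, hessianCoeff f r l 2 0 1 y = 0 ∧ hessianCoeff f r l 0 1 2 y = 0 ∧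
      hessianCoeff f r l 1 2 0 y = 0 := by
    filter_upwards [hev, hV.isOpen.mem_nhds hx] with y hy hyV
    by_contra hcon
    refine hy (hV.mixedResidual_eq_zero_of_ne hyV ?_)
    tauto
  exact hne (hV.mixedResidual_eq_zero_of_eventually hx (hzero.mono fun y h => h.1)
    (hzero.mono fun y h => h.2.1) (hzero.mono fun y h => h.2.2))

end MixedThirdDerivative

/-! ### Uniqueness of linear functions of the Plücker coordinates with a given second jet -/

section Uniqueness

-- Needed for the norm on spaces of trilinear maps.
set_option maxSynthPendingDepth 3

theorem exists_eventually_norm_le {X G ι : Type*} [TopologicalSpace X] [NormedAddCommGroup G]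
    [Fintype ι] {g : ι → X → G} {x : X} (h : ∀ i, ContinuousAt (g i) x) :
    ∃ C : ℝ, ∀ᶠ y in 𝓝 x, ∀ i, ‖g i y‖ ≤ C := by
  refine ⟨∑ i, (‖g i x‖ + 1), eventually_all.2 fun i => ?_⟩
  have h1 : ‖g i x‖ < ∑ i, (‖g i x‖ + 1) :=
    (lt_add_one _).trans_le (Finset.single_le_sum (f := fun i => ‖g i x‖ + 1)
      (fun j _ => by positivity) (Finset.mem_univ i))
  filter_upwards [(h i).norm.eventually_lt_const h1] with y hy using hy.le

theorem symmetric_apply_of_ne {T : Fin 3 → Fin 3 → Fin 3 → ℝ} (h1 : ∀ i j k, T i j k = T j i k)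
    (h2 : ∀ i j k, T i j k = T i k j) {i j k : Fin 3} (hij : i ≠ j) (hjk : j ≠ k) (hki : k ≠ i) :
    T i j k = T 0 1 2 := by
  fin_cases i <;> fin_cases j <;> fin_cases k <;>
    first | exact absurd rfl hij | exact absurd rfl hjk | exact absurd rfl hki | skip
  · rfl
  · exact h2 0 2 1
  · exact h1 1 0 2
  · exact (h2 1 2 0).trans (h1 1 0 2)
  · exact (h1 2 0 1).trans (h2 0 2 1)
  · exact (h1 2 1 0).trans ((h2 1 2 0).trans (h1 1 0 2))

theorem abs_trilinear_le {E : Type*} [NormedAddCommGroup E] [NormedSpace ℝ E]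
    {T : E →L[ℝ] E →L[ℝ] E →L[ℝ] ℝ} {r : Fin 3 → E} {l : Fin 3 → (E →L[ℝ] ℝ)}
    (hl : ∀ v, ∑ i, l i v • r i = v) {C K : ℝ} (hC : ∀ i, ‖l i‖ ≤ C)
    (hK : ∀ i j k, |T (r i) (r j) (r k)| ≤ K) : ‖T‖ ≤ 27 * C ^ 3 * K := by
  have hC0 : 0 ≤ C := (norm_nonneg _).trans (hC 0)
  have hK0 : 0 ≤ K := (abs_nonneg _).trans (hK 0 0 0)
  have hb : ∀ i v, |l i v| ≤ C * ‖v‖ := fun i v =>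
    ((l i).le_opNorm v).trans (mul_le_mul_of_nonneg_right (hC i) (norm_nonneg v))
  refine T.opNorm_le_bound (by positivity) fun a => ?_
  refine (T a).opNorm_le_bound (by positivity) fun b => ?_
  refine (T a b).opNorm_le_bound (by positivity) fun c => ?_
  have hexp : T a b c = ∑ i, ∑ j, ∑ k, l i a * (l j b * (l k c * T (r i) (r j) (r k))) := by
    conv_lhs => rw [← hl a, ← hl b, ← hl c]
    simp only [map_sum, map_smul, sum_apply, smul_apply, smul_eq_mul, Finset.mul_sum]
    simp only [Fin.sum_univ_three]
    ring
  have hterm : ∀ i j k, |l i a * (l j b * (l k c * T (r i) (r j) (r k)))|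
      ≤ C ^ 3 * K * ‖a‖ * ‖b‖ * ‖c‖ := by
    intro i j k
    rw [abs_mul, abs_mul, abs_mul]
    calc _ ≤ (C * ‖a‖) * ((C * ‖b‖) * ((C * ‖c‖) * K)) := by
          gcongr
          exacts [hb i a, hb j b, hb k c, hK i j k]
      _ = _ := by ring
  rw [hexp, Real.norm_eq_abs]
  calc _ ≤ ∑ _i : Fin 3, ∑ _j : Fin 3, ∑ _k : Fin 3, C ^ 3 * K * ‖a‖ * ‖b‖ * ‖c‖ := by
        refine (Finset.abs_sum_le_sum_abs _ _).trans (Finset.sum_le_sum fun i _ => ?_)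
        refine (Finset.abs_sum_le_sum_abs _ _).trans (Finset.sum_le_sum fun j _ => ?_)
        exact (Finset.abs_sum_le_sum_abs _ _).trans (Finset.sum_le_sum fun k _ => hterm i j k)
    _ = _ := by
        simp only [Finset.sum_const, Finset.card_univ, Fintype.card_fin, nsmul_eq_mul]
        push_cast
        ring

variable {f : (Fin 3 → ℝ) → (Fin 3 → ℝ)} {U V : Set (Fin 3 → ℝ)}
  {lam : Fin 3 → (Fin 3 → ℝ) → ℝ} {r : Fin 3 → (Fin 3 → ℝ) → (Fin 3 → ℝ)}
  {l : Fin 3 → (Fin 3 → ℝ) → ((Fin 3 → ℝ) →L[ℝ] ℝ)} {x : Fin 3 → ℝ}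
  {α : ℝ} {β γ : (Fin 3 → ℝ) →L[ℝ] ℝ} {δ : (Fin 3 → ℝ) →L[ℝ] (Fin 3 → ℝ) →L[ℝ] ℝ}

/-- `D³ψ` is locally bounded by `D²ψ`, as all its components in the frame are combinations of
components of `D²ψ` with continuous coefficients. -/
theorem IsIsotropicEigenframe.exists_norm_thirdFDeriv_le
    (hV : IsIsotropicEigenframe f lam V r l) (hδ : ∀ a b, δ a b = - δ b a) (hx : x ∈ V) :
    ∃ K : ℝ, ∀ᶠ y in 𝓝 x, ‖fderiv ℝ (fderiv ℝ (fderiv ℝ (congruenceFunction f α β γ δ))) y‖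
      ≤ K * ‖fderiv ℝ (fderiv ℝ (congruenceFunction f α β γ δ)) y‖ := by
  have hVx := hV.isOpen.mem_nhds hx
  obtain ⟨C₁, h₁⟩ := exists_eventually_norm_le fun i => (hV.contDiffAt_r hx i).continuousAt
  obtain ⟨C₂, h₂⟩ := exists_eventually_norm_le fun i => (hV.contDiffAt_l hx i).continuousAt
  obtain ⟨C₃, h₃⟩ := exists_eventually_norm_le (g := fun i => fderiv ℝ (r i)) (x := x) fun i =>
    ((hV.contDiffAt_r hx i).fderiv_right (m := 1) (by norm_num)).continuousAt
  obtain ⟨C₄, h₄⟩ := exists_eventually_norm_le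
    (g := ![logGapDeriv f lam r l 0 1 2, logGapDeriv f lam r l 1 2 0, logGapDeriv f lam r l 2 0 1])
    (x := x) fun i => by
      fin_cases i
      · exact (hV.continuousOn_logGapDeriv (by decide) 2).continuousAt hVx
      · exact (hV.continuousOn_logGapDeriv (by decide) 0).continuousAt hVx
      · exact (hV.continuousOn_logGapDeriv (by decide) 1).continuousAt hVx
  refine ⟨27 * C₂ ^ 3 * (2 * C₃ * C₁ ^ 2 + 3 * C₄ * C₁ ^ 2), ?_⟩
  filter_upwards [h₁, h₂, h₃, h₄, hVx] with y h₁ h₂ h₃ h₄ hy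
  have hψ := contDiffOn_congruenceFunction α β γ δ hV.smooth
  have hiso := hV.hessian_congruenceFunction_self (α := α) (β := β) (γ := γ) hδ
  have hthird := hV.thirdFDeriv_congruenceFunction_eq (α := α) (β := β) (γ := γ) hδ hy
  rw [hV.mixedResidual_eq_zero hy, map_zero, add_zero] at hthird
  have hleft := thirdFDeriv_comm_left hψ hV.isOpen hy
  have hright := thirdFDeriv_comm_right hψ hV.isOpen hy
  have hsame := hV.thirdFDeriv_apply_same hψ hiso hy
  set ψ₂ := fderiv ℝ (fderiv ℝ (congruenceFunction f α β γ δ)) y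
  have hC₁ : 0 ≤ C₁ := (norm_nonneg _).trans (h₁ 0)
  have hC₃ : 0 ≤ C₃ := (norm_nonneg _).trans (h₃ 0)
  have hC₄ : 0 ≤ C₄ := (norm_nonneg _).trans (h₄ 0)
  have hrep : ∀ k i, |fderiv ℝ (fderiv ℝ (fderiv ℝ (congruenceFunction f α β γ δ))) y
      (r k y) (r i y) (r i y)| ≤ (2 * C₃ * C₁ ^ 2 + 3 * C₄ * C₁ ^ 2) * ‖ψ₂‖ := by
    intro k i
    rw [hsame, smul_eq_mul, abs_mul]
    have h5 : ‖fderiv ℝ (r i) y (r k y)‖ ≤ C₃ * C₁ :=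
      (ContinuousLinearMap.le_opNorm _ _).trans (by gcongr; exacts [h₃ i, h₁ k])
    have h6 : |ψ₂ (fderiv ℝ (r i) y (r k y)) (r i y)| ≤ ‖ψ₂‖ * (C₃ * C₁) * C₁ :=
      (ψ₂.le_opNorm₂ _ _).trans (by gcongr; exact h₁ i)
    have h7 : 0 ≤ 3 * C₄ * C₁ ^ 2 * ‖ψ₂‖ := by positivity
    rw [abs_neg, abs_two]
    linarith
  have hdist : |fderiv ℝ (fderiv ℝ (fderiv ℝ (congruenceFunction f α β γ δ))) y
      (r 0 y) (r 1 y) (r 2 y)| ≤ (2 * C₃ * C₁ ^ 2 + 3 * C₄ * C₁ ^ 2) * ‖ψ₂‖ := by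
    have h6 : ∀ i j, |ψ₂ (r i y) (r j y)| ≤ ‖ψ₂‖ * C₁ * C₁ := fun i j =>
      (ψ₂.le_opNorm₂ _ _).trans (by gcongr; exacts [h₁ i, h₁ j])
    have h8 : ∀ c i j, |c| ≤ C₄ → |c * ψ₂ (r i y) (r j y)| ≤ C₄ * (‖ψ₂‖ * C₁ * C₁) := by
      intro c i j hc
      rw [abs_mul]
      exact mul_le_mul hc (h6 i j) (abs_nonneg _) hC₄
    have h7 : 0 ≤ 2 * C₃ * C₁ ^ 2 * ‖ψ₂‖ := by positivity
    rw [hthird]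
    refine (abs_add_three _ _ _).trans ?_
    linarith [h8 (logGapDeriv f lam r l 0 1 2 y) 0 1 (h₄ 0),
      h8 (logGapDeriv f lam r l 1 2 0 y) 1 2 (h₄ 1), h8 (logGapDeriv f lam r l 2 0 1 y) 2 0 (h₄ 2)]
  rw [mul_assoc]
  refine abs_trilinear_le (hV.sum_smul hy) h₂ fun i j k => ?_
  by_cases hjk : j = k
  · subst hjk
    exact hrep i j
  by_cases hki : k = i
  · subst hki
    rw [hleft]
    exact hrep j k
  by_cases hij : i = j
  · subst hij
    rw [hright, hleft]
    exact hrep k i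
  rw [symmetric_apply_of_ne (T := fun i j k => fderiv ℝ (fderiv ℝ (fderiv ℝ
    (congruenceFunction f α β γ δ))) y (r i y) (r j y) (r k y)) (fun i j k => hleft _ _ _)
    (fun i j k => hright _ _ _) hij hjk hki]
  exact hdist

/-- Local uniqueness, by Grönwall's inequality along the segments starting at `x`. -/
theorem IsIsotropicEigenframe.eventually_congruenceFunction_eq_zero
    (hV : IsIsotropicEigenframe f lam V r l) (hδ : ∀ a b, δ a b = - δ b a) (hx : x ∈ V)
    (h0 : congruenceFunction f α β γ δ x = 0)
    (h1 : fderiv ℝ (congruenceFunction f α β γ δ) x = 0)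
    (h2 : fderiv ℝ (fderiv ℝ (congruenceFunction f α β γ δ)) x = 0) :
    ∀ᶠ y in 𝓝 x, congruenceFunction f α β γ δ y = 0 := by
  obtain ⟨K, hK⟩ := hV.exists_norm_thirdFDeriv_le (α := α) (β := β) (γ := γ) hδ hx
  obtain ⟨ε, hε, hball⟩ := Metric.eventually_nhds_iff_ball.1
    (hK.and (hV.isOpen.eventually_mem hx))
  have hψ := contDiffOn_congruenceFunction α β γ δ hV.smooth
  have hψ1 := hψ.fderiv_infty hV.isOpen
  have hψ2 := hψ1.fderiv_infty hV.isOpen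
  set ψ := congruenceFunction f α β γ δ
  have hzero2 : ∀ y ∈ Metric.ball x ε, fderiv ℝ (fderiv ℝ ψ) y = 0 := by
    intro y hy
    have hseg : ∀ t ∈ Set.Icc (0 : ℝ) 1, x + t • (y - x) ∈ Metric.ball x ε := fun t ht =>
      (convex_ball x ε).add_smul_sub_mem (Metric.mem_ball_self hε) hy ht
    have hd : ∀ t ∈ Set.Icc (0 : ℝ) 1, HasDerivAt (fun t : ℝ => fderiv ℝ (fderiv ℝ ψ)
        (x + t • (y - x))) (fderiv ℝ (fderiv ℝ (fderiv ℝ ψ)) (x + t • (y - x)) (y - x)) t := by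
      intro t ht
      have h3 := (hψ2.differentiableAt_infty hV.isOpen (hball _ (hseg t ht)).2).hasFDerivAt
      have h4 : HasDerivAt (fun t : ℝ => x + t • (y - x)) (y - x) t := by
        simpa using ((hasDerivAt_id t).smul_const (y - x)).const_add x
      exact h3.comp_hasDerivAt t h4
    have h5 := eq_zero_of_abs_deriv_le_mul_abs_self_of_eq_zero_right (K := K * ‖y - x‖)
      (fun t ht => (hd t ht).continuousAt.continuousWithinAt)
      (fun t ht => (hd t (Set.Ico_subset_Icc_self ht)).hasDerivWithinAt)
      (by simpa using h2) (fun t ht => ?_) 1 (by simp)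
    · simpa using h5
    · refine (ContinuousLinearMap.le_opNorm _ _).trans ?_
      have h6 := (hball _ (hseg t (Set.Ico_subset_Icc_self ht))).1
      calc _ ≤ K * ‖fderiv ℝ (fderiv ℝ ψ) (x + t • (y - x))‖ * ‖y - x‖ := by gcongr
        _ = _ := by ring
  have hxb : x ∈ Metric.ball x ε := Metric.mem_ball_self hε
  have hpre : IsPreconnected (Metric.ball x ε) := (convex_ball x ε).isPreconnected
  have hzero1 : ∀ y ∈ Metric.ball x ε, fderiv ℝ ψ y = 0 := fun y hy => by
    rw [← h1]
    exact Metric.isOpen_ball.is_const_of_fderiv_eq_zero hpre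
      (fun z hz => (hψ1.differentiableAt_infty hV.isOpen
        (hball z hz).2).differentiableWithinAt) hzero2 hy hxb
  filter_upwards [Metric.ball_mem_nhds x hε] with y hy
  rw [← h0]
  exact Metric.isOpen_ball.is_const_of_fderiv_eq_zero hpre
    (fun z hz => (hψ.differentiableAt_infty hV.isOpen (hball z hz).2).differentiableWithinAt)
    hzero1 hy hxb

/-- Global uniqueness: the set of points where the second jet vanishes is open and closed. -/
theorem congruenceFunction_eq_zero (hU : IsOpen U) (hUc : IsPreconnected U)
    (hf : ContDiffOn ℝ ∞ f U)
    (hframe : ∀ y ∈ U, ∃ V r l, y ∈ V ∧ IsIsotropicEigenframe f lam V r l)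
    (hδ : ∀ a b, δ a b = - δ b a) (hx : x ∈ U)
    (h0 : congruenceFunction f α β γ δ x = 0)
    (h1 : fderiv ℝ (congruenceFunction f α β γ δ) x = 0)
    (h2 : fderiv ℝ (fderiv ℝ (congruenceFunction f α β γ δ)) x = 0) :
    ∀ y ∈ U, congruenceFunction f α β γ δ y = 0 := by
  have hψ := contDiffOn_congruenceFunction α β γ δ hf
  have hψ1 := hψ.fderiv_infty hU
  have hψ2 := hψ1.fderiv_infty hU
  set ψ := congruenceFunction f α β γ δ
  let Z : Set (Fin 3 → ℝ) := {y | ψ =ᶠ[𝓝 y] 0}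
  have hZo : IsOpen Z := isOpen_setOfPred_eventually_nhds
  have hxZ : x ∈ Z := by
    obtain ⟨V, r, l, hxV, hV⟩ := hframe x hx
    exact hV.eventually_congruenceFunction_eq_zero hδ hxV h0 h1 h2
  have hsub : U ⊆ Z := by
    refine hUc.subset_of_closure_inter_subset hZo ⟨x, hx, hxZ⟩ ?_
    rintro y ⟨hyc, hy⟩
    obtain ⟨V, r, l, hyV, hV⟩ := hframe y hy
    have hjet : ∀ z ∈ Z, ψ z = 0 ∧ fderiv ℝ ψ z = 0 ∧ fderiv ℝ (fderiv ℝ ψ) z = 0 := by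
      intro z hz
      have h3 : fderiv ℝ ψ =ᶠ[𝓝 z] 0 := by
        have := hz.fderiv (𝕜 := ℝ)
        simpa [Pi.zero_def] using! this
      refine ⟨hz.self_of_nhds, h3.self_of_nhds, ?_⟩
      rw [h3.fderiv_eq]
      simp [Pi.zero_def]
    have hlim : ∀ {G : Type} [NormedAddCommGroup G] (g : (Fin 3 → ℝ) → G), ContinuousOn g U →
        (∀ z ∈ Z, g z = 0) → g y = 0 := by
      intro G _ g hg hgZ
      have hne : (𝓝[Z] y).NeBot := mem_closure_iff_nhdsWithin_neBot.1 hyc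
      refine tendsto_nhds_unique (f := g) (l := 𝓝[Z] y)
        ((hg.continuousAt (hU.mem_nhds hy)).tendsto.mono_left nhdsWithin_le_nhds)
        (tendsto_const_nhds.congr' ?_)
      filter_upwards [self_mem_nhdsWithin] with z hz using (hgZ z hz).symm
    exact hV.eventually_congruenceFunction_eq_zero hδ hyV
      (hlim _ hψ.continuousOn fun z hz => (hjet z hz).1)
      (hlim _ hψ1.continuousOn fun z hz => (hjet z hz).2.1)
      (hlim _ hψ2.continuousOn fun z hz => (hjet z hz).2.2)
  exact fun y hy => (hsub hy).self_of_nhds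

/-- For each covector `g` there is a linear equation satisfied by the congruence for which
`γ + δ x = g`. -/
theorem exists_congruenceFunction_eq_zero (hU : IsOpen U) (hUc : IsPreconnected U)
    (hf : ContDiffOn ℝ ∞ f U)
    (hframe : ∀ y ∈ U, ∃ V r l, y ∈ V ∧ IsIsotropicEigenframe f lam V r l) (hx : x ∈ U)
    (g : (Fin 3 → ℝ) →L[ℝ] ℝ) :
    ∃ (α : ℝ) (β γ : (Fin 3 → ℝ) →L[ℝ] ℝ) (δ : (Fin 3 → ℝ) →L[ℝ] (Fin 3 → ℝ) →L[ℝ] ℝ),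
      (∀ a b, δ a b = - δ b a) ∧ γ + δ x = g ∧ ∀ y ∈ U, congruenceFunction f α β γ δ y = 0 := by
  obtain ⟨V, r, l, hxV, hV⟩ := hframe x hx
  obtain ⟨δ, hδ, h2⟩ := hV.exists_hessian_eq_zero hxV g
  -- `β` annuls the differential at `x`, and then `α` annuls the value.
  let β : (Fin 3 → ℝ) →L[ℝ] ℝ := -(g ∘L fderiv ℝ f x + δ.flip (f x))
  refine ⟨-(β x + g (f x)), β, g - δ x, δ, hδ, by simp,
    congruenceFunction_eq_zero hU hUc hf hframe hδ hx ?_ ?_ (h2 _ _)⟩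
  · simp only [congruenceFunction, sub_apply]
    ring
  · ext1 a
    rw [fderiv_congruenceFunction _ _ _ _ hV.smooth hV.isOpen hxV]
    simp [β]
    ring

/-- A linear equation satisfied by the congruence is trivial if its coefficient `γ + δ x` at `p`
vanishes at one point `x`. -/
theorem IsIsotropicEigenframe.eq_zero_of_congruenceFunction_eq_zero
    (hV : IsIsotropicEigenframe f lam V r l) (hδ : ∀ a b, δ a b = - δ b a) (hx : x ∈ V)
    (h : ∀ᶠ y in 𝓝 x, congruenceFunction f α β γ δ y = 0) (hg : γ + δ x = 0) :
    γ = 0 ∧ δ = 0 := by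
  have h1 : fderiv ℝ (congruenceFunction f α β γ δ) =ᶠ[𝓝 x] 0 := by
    have h' : congruenceFunction f α β γ δ =ᶠ[𝓝 x] fun _ => 0 := h
    simpa [Pi.zero_def] using! h'.fderiv (𝕜 := ℝ)
  have h2 : fderiv ℝ (fderiv ℝ (congruenceFunction f α β γ δ)) x = 0 := by
    rw [h1.fderiv_eq]
    simp [Pi.zero_def]
  have hδ0 : δ = 0 := hV.bilinear_ext hx fun i j => by
    have h3 := hV.hessian_congruenceFunction (α := α) (β := β) (γ := γ) hδ hx i j
    rw [h2, hg] at h3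
    by_cases hij : i = j
    · subst hij
      linarith [hδ (r i x) (r i x)]
    · have : lam j x - lam i x ≠ 0 := sub_ne_zero.2 ((hV.injective x hx).ne (Ne.symm hij))
      simpa [this] using h3
  exact ⟨by simpa [hδ0] using hg, hδ0⟩

end Uniqueness

/-! ### Linearity of the congruence -/

section Linear

variable {f : (Fin 3 → ℝ) → (Fin 3 → ℝ)} {U : Set (Fin 3 → ℝ)}
  {lam : Fin 3 → (Fin 3 → ℝ) → ℝ}

/-- The linear function `α + β(u) + γ(p) + δ(u, p)` of the Plücker coordinates `1`, `u^i`, `p^i`,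
`u^i p^j - u^j p^i` of lines in `P^4`, for an alternating form `δ`. -/
def pluckerFunctional (α : ℝ) (β γ : (Fin 3 → ℝ) →L[ℝ] ℝ)
    (δ : (Fin 3 → ℝ) →L[ℝ] (Fin 3 → ℝ) →L[ℝ] ℝ) : Dual ℝ (PluckerSpace 5) :=
  let c : {q : Fin 5 × Fin 5 // q.1 < q.2} → Dual ℝ (PluckerSpace 5) := LinearMap.proj
  α • c ⟨(0, 1), by decide⟩
    + (β (Pi.single 0 1) • c ⟨(0, 2), by decide⟩ + β (Pi.single 1 1) • c ⟨(0, 3), by decide⟩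
      + β (Pi.single 2 1) • c ⟨(0, 4), by decide⟩)
    + (γ (Pi.single 0 1) • c ⟨(1, 2), by decide⟩ + γ (Pi.single 1 1) • c ⟨(1, 3), by decide⟩
      + γ (Pi.single 2 1) • c ⟨(1, 4), by decide⟩)
    + (δ (Pi.single 0 1) (Pi.single 1 1) • c ⟨(2, 3), by decide⟩
      + δ (Pi.single 0 1) (Pi.single 2 1) • c ⟨(2, 4), by decide⟩
      + δ (Pi.single 1 1) (Pi.single 2 1) • c ⟨(3, 4), by decide⟩)

theorem pluckerFunctional_linePlucker {α : ℝ} {β γ : (Fin 3 → ℝ) →L[ℝ] ℝ}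
    {δ : (Fin 3 → ℝ) →L[ℝ] (Fin 3 → ℝ) →L[ℝ] ℝ} (hδ : ∀ a b, δ a b = - δ b a)
    (u p : Fin 3 → ℝ) :
    pluckerFunctional α β γ δ (linePlucker u p) = α + β u + γ p + δ u p := by
  have hexp : ∀ v : Fin 3 → ℝ, v = v 0 • Pi.single 0 1 + v 1 • Pi.single 1 1
      + v 2 • Pi.single 2 1 := by
    intro v
    ext i
    fin_cases i <;> simp
  have hβ : ∀ g : (Fin 3 → ℝ) →L[ℝ] ℝ, ∀ v, g v = v 0 * g (Pi.single 0 1)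
      + v 1 * g (Pi.single 1 1) + v 2 * g (Pi.single 2 1) := by
    intro g v
    conv_lhs => rw [hexp v]
    simp
  have hu : δ u p = u 0 * δ (Pi.single 0 1) p + u 1 * δ (Pi.single 1 1) p
      + u 2 * δ (Pi.single 2 1) p := hβ (δ.flip p) u
  have h0 : ∀ a, δ a a = 0 := fun a => by linarith [hδ a a]
  rw [hu, hβ (δ (Pi.single 0 1)) p, hβ (δ (Pi.single 1 1)) p, hβ (δ (Pi.single 2 1)) p,
    h0, h0, h0, hδ (Pi.single 1 1) (Pi.single 0 1), hδ (Pi.single 2 1) (Pi.single 0 1),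
    hδ (Pi.single 2 1) (Pi.single 1 1), hβ β u, hβ γ p]
  have e2 : (2 : Fin 5) = (0 : Fin 3).succ.succ := rfl
  have e3 : (3 : Fin 5) = (1 : Fin 3).succ.succ := rfl
  have e4 : (4 : Fin 5) = (2 : Fin 3).succ.succ := rfl
  simp only [pluckerFunctional, linePlucker, pluckerCoords, LinearMap.add_apply,
    LinearMap.smul_apply, LinearMap.proj_apply, affinePoint, pointAtInfinity, smul_eq_mul]
  simp only [e2, e3, e4, Matrix.cons_val_succ, Matrix.cons_val_zero, Matrix.cons_val_one,
    Pi.neg_apply]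
  ring

theorem sum_mul_congruenceFunction {n : ℕ} {ι : Type*} [Fintype ι]
    (f : (Fin n → ℝ) → (Fin n → ℝ)) (c α : ι → ℝ) (β γ : ι → ((Fin n → ℝ) →L[ℝ] ℝ))
    (δ : ι → ((Fin n → ℝ) →L[ℝ] (Fin n → ℝ) →L[ℝ] ℝ)) (u : Fin n → ℝ) :
    congruenceFunction f (∑ k, c k * α k) (∑ k, c k • β k) (∑ k, c k • γ k) (∑ k, c k • δ k) u
      = ∑ k, c k * congruenceFunction f (α k) (β k) (γ k) (δ k) u := by
  simp [congruenceFunction, sum_apply, mul_add, Finset.sum_add_distrib]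

theorem isLinearCongruence_of_isIsotropicEigenframe (hU : IsOpen U) (hUc : IsConnected U)
    (hf : ContDiffOn ℝ ∞ f U)
    (hframe : ∀ y ∈ U, ∃ V r l, y ∈ V ∧ IsIsotropicEigenframe f lam V r l) :
    IsLinearCongruence f U := by
  obtain ⟨u₀, hu₀⟩ := hUc.nonempty
  choose α β γ δ hδ hg hψ using fun k : Fin 3 => exists_congruenceFunction_eq_zero hU
    hUc.isPreconnected hf hframe hu₀ (ContinuousLinearMap.proj k)
  have hg' : ∀ (k : Fin 3) (p : Fin 3 → ℝ), γ k p + δ k u₀ p = p k := fun k p =>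
    congrArg (fun g : (Fin 3 → ℝ) →L[ℝ] ℝ => g p) (hg k)
  refine ⟨fun k => pluckerFunctional (α k) (β k) (γ k) (δ k), ?_, fun u hu p => ?_⟩
  · rw [Fintype.linearIndependent_iff]
    intro c hc i
    have h1 : ∀ p : Fin 3 → ℝ, ∑ k, c k * (α k + β k u₀ + p k) = 0 := by
      intro p
      have := LinearMap.congr_fun hc (linePlucker u₀ p)
      simp only [LinearMap.sum_apply, LinearMap.smul_apply,
        pluckerFunctional_linePlucker (hδ _), smul_eq_mul, LinearMap.zero_apply] at this
      rw [← this]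
      refine Finset.sum_congr rfl fun k _ => ?_
      rw [← hg' k p]
      ring
    have h2 := h1 0
    have h3 := h1 (Pi.single i 1)
    simp only [mul_add, Finset.sum_add_distrib] at h2 h3
    simp [Pi.single_apply] at h2 h3
    linarith
  have hind : LinearIndependent ℝ
      fun k => ((γ k + δ k u : (Fin 3 → ℝ) →L[ℝ] ℝ) : Dual ℝ (Fin 3 → ℝ)) := by
    rw [Fintype.linearIndependent_iff]
    intro c hc
    obtain ⟨V, r, l, huV, hV⟩ := hframe u hu
    have h0 : (∑ k, c k • γ k) + (∑ k, c k • δ k) u = 0 := by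
      ext1 p
      have := LinearMap.congr_fun hc p
      simpa [sum_apply, LinearMap.sum_apply, mul_add, Finset.sum_add_distrib] using this
    obtain ⟨hγ0, hδ0⟩ := hV.eq_zero_of_congruenceFunction_eq_zero
      (α := ∑ k, c k * α k) (β := ∑ k, c k • β k)
      (fun a b => by
        simp only [sum_apply, smul_apply, smul_eq_mul, ← Finset.sum_neg_distrib]
        exact Finset.sum_congr rfl fun k _ => by rw [hδ k a b]; ring) huV
      (by
        filter_upwards [hU.mem_nhds hu] with y hy
        rw [sum_mul_congruenceFunction]
        exact Finset.sum_eq_zero fun k _ => by rw [hψ k y hy, mul_zero]) h0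
    intro i
    have h1 : ∑ k, c k * (γ k (Pi.single i 1) + δ k u₀ (Pi.single i 1)) = 0 := by
      have h2 := congrArg (fun g : (Fin 3 → ℝ) →L[ℝ] ℝ => g (Pi.single i 1)) hγ0
      have h3 := congrArg (fun d : (Fin 3 → ℝ) →L[ℝ] (Fin 3 → ℝ) →L[ℝ] ℝ =>
        d u₀ (Pi.single i 1)) hδ0
      simp only [sum_apply, smul_apply, smul_eq_mul, zero_apply] at h2 h3
      simp only [mul_add, Finset.sum_add_distrib, h2, h3, add_zero]
    simpa [hg', Pi.single_apply] using h1
  have hval : ∀ k, pluckerFunctional (α k) (β k) (γ k) (δ k) (linePlucker u p)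
      = (γ k + δ k u) (p - f u) := by
    intro k
    have := hψ k u hu
    rw [congruenceFunction] at this
    rw [pluckerFunctional_linePlucker (hδ k), add_apply, map_sub, map_sub]
    linarith
  simp only [hval]
  constructor
  · intro h
    have hspan := hind.span_eq_top_of_card_eq_finrank' (by simp [Subspace.dual_finrank_eq])
    have hall : ∀ φ : Dual ℝ (Fin 3 → ℝ), φ (p - f u) = 0 := by
      intro φ
      have hle : Submodule.span ℝ (Set.range fun k =>
          ((γ k + δ k u : (Fin 3 → ℝ) →L[ℝ] ℝ) : Dual ℝ (Fin 3 → ℝ)))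
          ≤ LinearMap.ker (Dual.eval ℝ (Fin 3 → ℝ) (p - f u)) := by
        rw [Submodule.span_le]
        rintro _ ⟨k, rfl⟩
        exact h k
      exact hle (hspan ▸ Submodule.mem_top)
    rw [← sub_eq_zero]
    funext i
    exact hall (LinearMap.proj i)
  · rintro rfl k
    simp

theorem IsTSystem.isLinearCongruence (hU : IsOpen U) (hUc : IsConnected U)
    (hf : ContDiffOn ℝ ∞ f U) (hyp : IsStrictlyHyperbolic f U lam) (hT : IsTSystem f U lam) :
    IsLinearCongruence f U := by
  refine isLinearCongruence_of_isIsotropicEigenframe (lam := lam) hU hUc hf fun y hy => ?_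
  obtain ⟨V, r, l, hyV, hVU, hV⟩ := hyp.exists_eigenframe hU hf hy
  exact ⟨V, r, l, hyV, hV, hf.mono hVU, fun x hx => (hyp x (hVU hx)).1.injective,
    fun x hx i => hT.fderiv_fderiv_eigenvector hU hf hV hVU hx i⟩

end Linear

end

theorem theorem8 (f : (Fin 3 → ℝ) → (Fin 3 → ℝ)) (U : Set (Fin 3 → ℝ))
    (lam : Fin 3 → (Fin 3 → ℝ) → ℝ)
    (hU : IsOpen U) (hUc : IsConnected U) (hf : ContDiffOn ℝ ∞ f U)
    (hyp : IsStrictlyHyperbolic f U lam) :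
    (IsTSystem f U lam ↔ DevelopablesArePlanarPencils f U) ∧
      (IsTSystem f U lam → IsLinearCongruence f U) :=
  ⟨⟨fun hT => hT.developablesArePlanarPencils hU hf hyp (by norm_num),
    fun hP => hP.isTSystem hU hf⟩, fun hT => hT.isLinearCongruence hU hUc hf hyp⟩
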